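/- All graphs are finite and simple; $v(G)$, $e(G)$ denote the numbers of vertices and edges, the average degree is $2e(G)/v(G)$, and $\mathbb N=\{1,2,\dots\}$. For a subgraph $H\subseteq G$, $G-H$ is $G$ with the edges of $H$ deleted; for $U\subseteq V(G)$, $G-U$ is the subgraph induced on $V(G)\setminus U$. For disjoint $U,W$ the density is $d(U,W)=e(U,W)/(|U||W|)$, and $(U,W)$ is $\epsilon$-regular if $|d(U,W)-d(U',W')|<\epsilon$ whenever $U'\subseteq U$, $W'\subseteq W$, $|U'|\ge\epsilon|U|$, $|W'|\ge\epsilon|W|$. An $(m,\gamma)$-dense spot in $G$ is a bipartite subgraph $D=(U,W;F)$ of $G$ with at least one edge, density greater than $\gamma$ and minimum degree greater than $m$ ($(U,W;F)$ and $(W,U;F)$ are identified). $G$ is $(m,\gamma)$-nowhere-dense if it contains no $(m,\gamma)$-dense spot. For a family $\mathcal D$ of dense spots in $G$, $G_{\mathcal D}$ is the union of its members. A set $\mathbb E\subseteq\bigcup_{D\in\mathcal D}V(D)$ is $(\Lambda,\epsilon,\gamma,k)$-avoiding with respect to $\mathcal D$ if for every $U\subseteq V(G)$ with $|U|\le\Lambda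 k$, all but at most $\epsilon k$ vertices $v\in\mathbb E$ lie in some $D\in\mathcal D$ with $|U\cap V(D)|\le\gamma^2k$. A tuple $(\mathbf V,\mathcal D,G_{\mathrm{reg}},G_{\mathrm{exp}},\mathbb E)$ is a $(k,\Lambda,\gamma,\epsilon,\nu,\rho)$-bounded decomposition of $G$ with respect to a partition $\mathcal V$ of $V(G)$ if: (1) $G_{\mathrm{exp}}$ is a $(\gamma k,\gamma)$-nowhere-dense subgraph of $G$ of minimum degree greater than $\rho k$ (no condition if it has no vertices); (2) $\mathbf V$ is a set of pairwise disjoint subsets of $V(G)$; (3) $G_{\mathrm{reg}}$ is a subgraph of $G-G_{\mathrm{exp}}$ on the vertex set $\bigcup\mathbf V$, and for each $xy\in E(G_{\mathrm{reg}})$ there are distinct $C_x\ni x$, $C_y\ni y$ in $\mathbf V$ such that $G[C_x,C_y]=G_{\mathrm{reg}}[C_x,C_y]$ and this is an $\epsilon$-regular pair of density at least $\gamma^2$; (4) $\nu k\le|C|=|C'|\le\epsilon k$ for all $C,C'\in\mathbf V$; (5) $\mathcal D$ is a family of edge-disjoint $(\gamma k,\gamma)$-dense spots in $G-G_{\mathrm{exp}}$,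 and for each $(U,W;F)\in\mathcal D$ every edge of $G$ between $U$ and $W$ lies in $G_{\mathcal D}$; (6) if $G_{\mathrm{reg}}$ has an edge between $C_1,C_2\in\mathbf V$, then there is $(U,W;F)\in\mathcal D$ with $C_1\subseteq U$, $C_2\subseteq W$; (7) each $C\in\mathbf V$ is contained in $V\cap V(G_{\mathrm{exp}})$ or in $V\setminus V(G_{\mathrm{exp}})$ for some $V\in\mathcal V$, and $C\cap U,\,C\cap W\in\{\emptyset,C\}$ for each $(U,W;F)\in\mathcal D$; (8) $\mathbb E$ is a subset of $V(G)\setminus\bigcup\mathbf V$ that is $(\Lambda,\epsilon,\gamma,k)$-avoiding with respect to $\mathcal D$. A tuple $(\mathbb H,\mathbf V,\mathcal D,G_{\mathrm{reg}},G_{\mathrm{exp}},\mathbb E)$ is a $(k,\Omega^{**},\Omega^{*},\Lambda,\gamma,\epsilon,\nu,\rho)$-sparse decomposition of $G$ with respect to $V_1,\dots,V_s$ (a partition of $V(G)$; the trivial partition $\{V(G)\}$ if none is mentioned) if $\mathbb H\subseteq V(G)$; every vertex of $\mathbb H$ has degree at least $\Omega^{**}k$ in $G$; every vertex outside $\mathbb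 H$ has degree at most $\Omega^{*}k$ in the graph formed by the edges of $G_{\mathcal D}$, the edges of $G_{\mathrm{exp}}$ and the edges of $G$ incident with $\mathbb H$; and $(\mathbf V,\mathcal D,G_{\mathrm{reg}},G_{\mathrm{exp}},\mathbb E)$ is a $(k,\Lambda,\gamma,\epsilon,\nu,\rho)$-bounded decomposition of $G-\mathbb H$ with respect to $V_1\setminus\mathbb H,\dots,V_s\setminus\mathbb H$. The captured edges are the edges of $G_{\mathrm{reg}}$, the edges of $G_{\mathrm{exp}}$, the edges of $G$ incident with $\mathbb H$, and the edges of $G_{\mathcal D}$ with one end in $\mathbb E$ and the other in $\mathbb E\cup\bigcup\mathbf V$. **Lemma.** For every $0<\eta\le4$ and $\Lambda,\gamma,\epsilon,\rho>0$ there are $\nu>0$ and $k_0\in\mathbb N$ such that for every sequence $(\Omega_j)_{j\in\mathbb N}$ of positive numbers with $\Omega_j/\Omega_{j+1}\le\eta/4$ for all $j$ the following holds. Let $G$ be a graph of order $n$ whose average degree $k$ (a real number) satisfies $k>k_0$. Then there are an index $i\in\mathbb N$ with $i\le4/\eta$ and a spanning subgraph $G'\subseteq G$ with $e(G)-e(G')\le\eta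 kn$ such that $G'$ has a $(k,\Omega_{i+1},\Omega_i,\Lambda,\gamma,\epsilon,\nu,\rho)$-sparse decomposition that captures all but at most $$\Big(\frac{4\epsilon}{\gamma}+\epsilon\,\Omega_{\lfloor4/\eta\rfloor}+\gamma+\rho\Big)kn$$ edges of $G'$, and hence all but at most $$\Big(\eta+\frac{4\epsilon}{\gamma}+\epsilon\,\Omega_{\lfloor4/\eta\rfloor}+\gamma+\rho\Big)kn$$ edges of $G$. -/

import Mathlib

namespace SparseDecomp

/-- The average degree `2 e(G) / v(G)` of a finite graph. -/
noncomputable def avgDegree {V : Type*} (G : SimpleGraph V) : ℝ :=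
  2 * (G.edgeSet.ncard : ℝ) / (Nat.card V : ℝ)

/-- The density `e(U, W) / (|U| |W|)` of a pair of vertex sets. -/
noncomputable def density {V : Type*} (G : SimpleGraph V) (U W : Finset V) : ℝ :=
  open Classical in ((G.edgeDensity U W : ℚ) : ℝ)

/-- `ε`-regular pairs: `|d(U, W) - d(U', W')| < ε` for all `U' ⊆ U`, `W' ⊆ W` with
`|U'| ≥ ε |U|`, `|W'| ≥ ε |W|`. -/
def IsRegularPair {V : Type*} (G : SimpleGraph V) (ε : ℝ) (U W : Finset V) : Prop :=
  open Classical in Disjoint U W ∧ G.IsUniform ε U W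

/-- A bipartite subgraph `(U, W; F)` of `G` with colour classes `left = U` and `right = W`. -/
structure BipSubgraph {V : Type*} (G : SimpleGraph V) where
  left : Finset V
  right : Finset V
  graph : G.Subgraph
  verts_eq : graph.verts = (left : Set V) ∪ (right : Set V)
  bipartite : graph.spanningCoe.IsBipartiteWith (left : Set V) (right : Set V)

/-- `D` is an `(m, γ)`-dense spot in the graph `B`. Here, as everywhere below, the graph `B` under
consideration is a subgraph of an ambient graph `G`, with its own vertex set `B.verts`. -/
def IsDenseSpot {V : Type*} {G : SimpleGraph V} (B : G.Subgraph) (m γ : ℝ)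
    (D : BipSubgraph G) : Prop :=
  D.graph ≤ B ∧ D.graph.edgeSet.Nonempty ∧
    γ < density D.graph.spanningCoe D.left D.right ∧
    ∀ v ∈ D.graph.verts, m < ((D.graph.neighborSet v).ncard : ℝ)

/-- `B` contains no `(m, γ)`-dense spot. -/
def IsNowhereDense {V : Type*} {G : SimpleGraph V} (B : G.Subgraph) (m γ : ℝ) : Prop :=
  ∀ D : BipSubgraph G, ¬ IsDenseSpot B m γ D

/-- The graph formed by all the edges (and vertices) of the members of the family `𝒟`. -/
def spotGraph {V : Type*} {G : SimpleGraph V} (𝒟 : Set (BipSubgraph G)) : G.Subgraph :=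
  ⨆ D ∈ 𝒟, D.graph

/-- `E` is a `(Λ, ε, γ, k)`-avoiding set in the graph `B` with respect to `𝒟`. -/
def IsAvoiding {V : Type*} {G : SimpleGraph V} (B : G.Subgraph) (Λ ε γ k : ℝ)
    (𝒟 : Set (BipSubgraph G)) (E : Set V) : Prop :=
  (∀ v ∈ E, ∃ D ∈ 𝒟, v ∈ D.graph.verts) ∧
  ∀ U : Set V, U ⊆ B.verts → (U.ncard : ℝ) ≤ Λ * k →
    (({v ∈ E | ¬ ∃ D ∈ 𝒟, v ∈ D.graph.verts ∧
      ((U ∩ D.graph.verts).ncard : ℝ) ≤ γ ^ 2 * k}).ncard : ℝ) ≤ ε * k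

/-- `(clusters, 𝒟, Greg, Gexp, E)` is a `(k, Λ, γ, ε, ν, ρ)`-bounded decomposition of the graph
`B` with respect to the partition `P 0, …, P (s - 1)` of the vertex set of `B`
(some of the parts may be empty). -/
structure IsBoundedDecomposition {V : Type*} {G : SimpleGraph V} (B : G.Subgraph)
    {s : ℕ} (P : Fin s → Set V) (k Λ γ ε ν ρ : ℝ)
    (clusters : Set (Finset V)) (𝒟 : Set (BipSubgraph G)) (Greg Gexp : G.Subgraph)
    (E : Set V) : Prop where
  exp_le : Gexp ≤ B
  exp_nowhereDense : IsNowhereDense Gexp (γ * k) γ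
  exp_minDegree : ∀ v ∈ Gexp.verts, ρ * k < ((Gexp.neighborSet v).ncard : ℝ)
  clusters_subset : ∀ C ∈ clusters, (C : Set V) ⊆ B.verts
  clusters_disjoint : ∀ C ∈ clusters, ∀ C' ∈ clusters, C ≠ C' → Disjoint C C'
  reg_le : Greg ≤ B.deleteEdges Gexp.edgeSet
  reg_verts : Greg.verts = {v | ∃ C ∈ clusters, v ∈ C}
  reg_pairs : ∀ x y, Greg.Adj x y → ∃ C ∈ clusters, ∃ C' ∈ clusters,
    C ≠ C' ∧ x ∈ C ∧ y ∈ C' ∧ (∀ a ∈ C, ∀ b ∈ C', B.Adj a b ↔ Greg.Adj a b) ∧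
    IsRegularPair B.spanningCoe ε C C' ∧ γ ^ 2 ≤ density B.spanningCoe C C'
  cluster_card_eq : ∀ C ∈ clusters, ∀ C' ∈ clusters, C.card = C'.card
  cluster_card_ge : ∀ C ∈ clusters, ν * k ≤ (C.card : ℝ)
  cluster_card_le : ∀ C ∈ clusters, (C.card : ℝ) ≤ ε * k
  spots_dense : ∀ D ∈ 𝒟, IsDenseSpot (B.deleteEdges Gexp.edgeSet) (γ * k) γ D
  spots_edgeDisjoint : ∀ D ∈ 𝒟, ∀ D' ∈ 𝒟, D ≠ D' →
    Disjoint D.graph.edgeSet D'.graph.edgeSet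
  spots_cover : ∀ D ∈ 𝒟, ∀ u ∈ D.left, ∀ w ∈ D.right, B.Adj u w → (spotGraph 𝒟).Adj u w
  reg_in_spot : ∀ C ∈ clusters, ∀ C' ∈ clusters, (∃ x ∈ C, ∃ y ∈ C', Greg.Adj x y) →
    ∃ D ∈ 𝒟, (C ⊆ D.left ∧ C' ⊆ D.right) ∨ (C ⊆ D.right ∧ C' ⊆ D.left)
  cluster_part : ∀ C ∈ clusters, ∃ j, (C : Set V) ⊆ P j ∩ Gexp.verts ∨
    (C : Set V) ⊆ P j \ Gexp.verts
  cluster_spot : ∀ C ∈ clusters, ∀ D ∈ 𝒟,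
    (Disjoint C D.left ∨ C ⊆ D.left) ∧ (Disjoint C D.right ∨ C ⊆ D.right)
  avoiding_subset : E ⊆ B.verts \ {v | ∃ C ∈ clusters, v ∈ C}
  avoiding : IsAvoiding B Λ ε γ k 𝒟 E

/-- The data `(H, clusters, 𝒟, Greg, Gexp, E)` of a sparse decomposition of `G`. -/
structure SparseData {V : Type*} (G : SimpleGraph V) where
  /-- the huge degree vertices -/
  H : Set V
  /-- the clusters -/
  clusters : Set (Finset V)
  /-- the dense spots -/
  spots : Set (BipSubgraph G)
  /-- the union of the regular pairs -/
  Greg : G.Subgraph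
  /-- the nowhere-dense part -/
  Gexp : G.Subgraph
  /-- the avoiding set -/
  E : Set V

/-- `∇` is a `(k, Ω₂, Ω₁, Λ, γ, ε, ν, ρ)`-sparse decomposition of `G` with respect to the
partition `P 0, …, P (s - 1)` of the vertex set of `G`. The set in the second clause is the
neighbourhood of `v` in the graph spanned by the edges of the dense spots, the edges of `Gexp`, and
the edges incident with `H`. -/
structure IsSparseDecomposition {V : Type*} {G : SimpleGraph V} {s : ℕ} (P : Fin s → Set V)
    (k Ω₂ Ω₁ Λ γ ε ν ρ : ℝ) (D : SparseData G) : Prop where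
  huge_degree : ∀ v ∈ D.H, Ω₂ * k ≤ ((G.neighborSet v).ncard : ℝ)
  bounded_degree : ∀ v, v ∉ D.H →
    (({w | (spotGraph D.spots).Adj v w ∨ D.Gexp.Adj v w ∨
      (G.Adj v w ∧ (v ∈ D.H ∨ w ∈ D.H))}).ncard : ℝ) ≤ Ω₁ * k
  bounded : IsBoundedDecomposition ((⊤ : G.Subgraph).deleteVerts D.H) (fun j => P j \ D.H)
    k Λ γ ε ν ρ D.clusters D.spots D.Greg D.Gexp D.E

/-- The edges captured by a sparse decomposition. -/
def SparseData.captured {V : Type*} {G : SimpleGraph V} (D : SparseData G) : Set (Sym2 V) :=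
  D.Greg.edgeSet ∪ D.Gexp.edgeSet ∪ {e ∈ G.edgeSet | ∃ v ∈ D.H, v ∈ e} ∪
    {e | ∃ x ∈ D.E, ∃ y, (y ∈ D.E ∨ ∃ C ∈ D.clusters, y ∈ C) ∧
      (spotGraph D.spots).Adj x y ∧ e = s(x, y)}

end SparseDecomp

/-! Write `n` for the number of vertices; then `k * n = 2 * e(G)`, and every loss is measured
against `k * n`. Pigeonhole over about `4 / η` degree scales gives an `i` for which the vertices of
degree in `[Ω i * k, Ω (i + 2) * k)` meet few edges. Deleting those edges and peeling the vertices
above this range leaves huge vertices `H`, while all others have degree at most `Ω i * k`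
(`exists_degree_gap`).

The graph `B` outside `H` has bounded degree in units of `k`. A family of edge-disjoint dense spots
covering as many edges as possible leaves a nowhere-dense rest (`exists_maximal_spotFamily`), and
peeling the rest gives `Gexp` (`exists_nowhereDense_part`). Colour each vertex by the sides of spots
containing it and by membership in `Gexp`. In `sidesGraph`, which joins opposite sides of spots, all
degrees are `O(k)` with a constant independent of `n`. Hence a cluster of size proportional to `k`
meets boundedly many others, and the energy-increment proof of the regularity lemma runs with
clusters of order `k` instead of `n`, losing at most `δ * k` vertices of each colour
(`exists_regular_family`).

The lost vertices that lie in spots form the avoiding set. A set `U` of size at most `Λ * k` meets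
only boundedly many spots heavily; a vertex all of whose spots are heavy has one of boundedly many
colours, and each colour has few lost vertices (`IsSpotFamily.isAvoiding`). The uncaptured edges lie
in irregular pairs, in pairs of density below `γ ^ 2`, or among the edges peeled from the
nowhere-dense rest (`IsGoodFamily.ncard_uncaptured_le`).

Since `ν` and `k₀` precede `Ω`, the degree bound must be uniform: either `ε * Ω ⌊4 / η⌋₊ < 1 / 2`,
so that `Ω i ≤ 1 / (2 * ε)`, or the allowed error exceeds `e(G)` and the empty decomposition
suffices. -/

namespace SparseDecomp

/-! ### Averages over fibres and the energy identity. -/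

section Energy

open Finset
open scoped Classical

variable {W κ κ' : Type*}

/-- `S` is a union of fibres of `r`. -/
def IsSaturated (r : W → κ) (S : Finset W) : Prop :=
  ∀ w ∈ S, ∀ z, r z = r w → z ∈ S

lemma IsSaturated.of_refines {r : W → κ} {r' : W → κ'} {S : Finset W} (hS : IsSaturated r S)
    (hr : ∀ w z, r' z = r' w → r z = r w) : IsSaturated r' S :=
  fun w hw z h => hS w hw z (hr w z h)

variable [Fintype W]

/-- The average of `f` over the fibre of `r` through `w`. -/
noncomputable def fiberAvg (r : W → κ) (f : W → ℝ) (w : W) : ℝ :=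
  (∑ z with r z = r w, f z) / (#{z | r z = r w} : ℝ)

lemma fiber_card_pos (r : W → κ) (w : W) : (0 : ℝ) < #{z | r z = r w} := by
  exact_mod_cast Finset.card_pos.mpr ⟨w, by simp⟩

lemma fiberAvg_congr {r : W → κ} (f : W → ℝ) {w w' : W} (h : r w = r w') :
    fiberAvg r f w = fiberAvg r f w' := by
  simp only [fiberAvg, h]

lemma fiberAvg_of_fiber {r : W → κ} (f : W → ℝ) {w : W} {S : Finset W}
    (h : ∀ z, r z = r w ↔ z ∈ S) : fiberAvg r f w = (∑ z ∈ S, f z) / #S := by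
  have : (univ.filter fun z => r z = r w) = S := by
    ext z
    simp [h]
  rw [fiberAvg, this]

/-- Each value `f z` is divided by the size of its fibre and then counted once per point of that
fibre; saturation keeps the whole fibre inside `S`. -/
lemma sum_fiberAvg {r : W → κ} {S : Finset W} (hS : IsSaturated r S) (f : W → ℝ) :
    ∑ w ∈ S, fiberAvg r f w = ∑ w ∈ S, f w := by
  have h1 : ∀ w ∈ S, fiberAvg r f w =
      ∑ z ∈ S, if r z = r w then f z / (#{y | r y = r z} : ℝ) else 0 := by
    intro w hw
    have : (univ.filter fun z => r z = r w) = S.filter fun z => r z = r w := by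
      ext z
      simpa using fun h => hS w hw z h
    rw [fiberAvg, sum_div, this, sum_filter]
    refine sum_congr rfl fun z _ => ?_
    split_ifs with h
    · rw [h, this]
    · rfl
  rw [sum_congr rfl h1, sum_comm]
  refine sum_congr rfl fun z hz => ?_
  have : (univ.filter fun y => r y = r z) = S.filter fun w => r z = r w := by
    ext y
    simp only [mem_filter, mem_univ, true_and]
    exact ⟨fun h => ⟨hS z hz y h, h.symm⟩, fun h => h.2.symm⟩
  rw [← sum_filter, sum_const, nsmul_eq_mul, ← this]
  field_simp [(fiber_card_pos r z).ne']

lemma fiberAvg_mul {r : W → κ} (f h : W → ℝ) (hh : ∀ w z, r z = r w → h z = h w) (w : W) :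
    fiberAvg r (fun z => f z * h z) w = fiberAvg r f w * h w := by
  rw [fiberAvg, fiberAvg, div_mul_eq_mul_div, sum_mul]
  congr 1
  refine sum_congr rfl fun z hz => ?_
  rw [hh w z (by simpa using hz)]

/-- Pythagoras' identity for a refinement. -/
lemma energy_sub {r : W → κ} {r' : W → κ'} {S : Finset W} (hS : IsSaturated r S)
    (hr : ∀ w z, r' z = r' w → r z = r w) (f : W → ℝ) :
    ∑ w ∈ S, fiberAvg r' f w ^ 2 = ∑ w ∈ S, fiberAvg r f w ^ 2 +
      ∑ w ∈ S, (fiberAvg r' f w - fiberAvg r f w) ^ 2 := by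
  -- Orthogonality: the coarse average is constant on fine fibres, so it can be moved inside the
  -- fine average, and the sum over `S` is then the same at the coarse level.
  have key : ∑ w ∈ S, fiberAvg r' f w * fiberAvg r f w = ∑ w ∈ S, fiberAvg r f w ^ 2 := by
    calc ∑ w ∈ S, fiberAvg r' f w * fiberAvg r f w
        = ∑ w ∈ S, fiberAvg r' (fun z => f z * fiberAvg r f z) w :=
          sum_congr rfl fun w _ =>
            (fiberAvg_mul f _ (fun w z h => fiberAvg_congr f (hr w z h)) w).symm
      _ = ∑ w ∈ S, fiberAvg r (fun z => f z * fiberAvg r f z) w := by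
          rw [sum_fiberAvg (hS.of_refines hr), sum_fiberAvg hS]
      _ = ∑ w ∈ S, fiberAvg r f w ^ 2 :=
          sum_congr rfl fun w _ => by
            rw [fiberAvg_mul f _ (fun w z h => fiberAvg_congr f h) w, sq]
  have : ∀ w, (fiberAvg r' f w - fiberAvg r f w) ^ 2 =
      fiberAvg r' f w ^ 2 - 2 * (fiberAvg r' f w * fiberAvg r f w) + fiberAvg r f w ^ 2 :=
    fun w => by ring
  simp only [this, sum_add_distrib, sum_sub_distrib, ← mul_sum, key]
  ring

/-- Cauchy–Schwarz. It turns a deviation of the density on a witness rectangle into a gain of energy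
there. -/
lemma sq_le_card_mul_sum_sq {r : W → κ} {S : Finset W} (hS : IsSaturated r S) (f : W → ℝ)
    (d : ℝ) : (∑ w ∈ S, f w - d * #S) ^ 2 ≤ #S * ∑ w ∈ S, (fiberAvg r f w - d) ^ 2 := by
  have h := sq_sum_le_card_mul_sum_sq (s := S) (f := fun w => fiberAvg r f w - d)
  rwa [sum_sub_distrib, sum_fiberAvg hS, sum_const, nsmul_eq_mul, mul_comm (#S : ℝ) d] at h

lemma fiberAvg_nonneg {r : W → κ} {f : W → ℝ} (hf : ∀ w, 0 ≤ f w) (w : W) :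
    0 ≤ fiberAvg r f w :=
  div_nonneg (sum_nonneg fun _ _ => hf _) (Nat.cast_nonneg _)

lemma fiberAvg_le_one {r : W → κ} {f : W → ℝ} (hf : ∀ w, f w ≤ 1) (w : W) :
    fiberAvg r f w ≤ 1 := by
  rw [fiberAvg, div_le_one (fiber_card_pos r w)]
  calc ∑ z with r z = r w, f z ≤ ∑ z with r z = r w, (1 : ℝ) := sum_le_sum fun _ _ => hf _
    _ = _ := by simp

end Energy

/-! ### Cutting sets into monochromatic pieces of equal size. -/

section Pieces

open Finset
open scoped Classical

variable {V κ : Type*}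

/-- A set can be cut, up to less than `c` elements of each colour, into monochromatic pieces of
size `c`. -/
lemma exists_monochromatic_pieces [Fintype V] (S : Finset V) (r : V → κ) {c : ℕ} (hc : 0 < c) :
    ∃ P : Finset (Finset V), (∀ X ∈ P, ∀ Y ∈ P, X ≠ Y → Disjoint X Y) ∧
      (∀ X ∈ P, #X = c ∧ X ⊆ S ∧ ∀ x ∈ X, ∀ y ∈ X, r x = r y) ∧
      ∀ a, #{x ∈ S | r x = a ∧ ∀ X ∈ P, x ∉ X} < c := by
  let good : Finset (Finset V) → Prop := fun P =>
    (∀ X ∈ P, ∀ Y ∈ P, X ≠ Y → Disjoint X Y) ∧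
      (∀ X ∈ P, #X = c ∧ X ⊆ S ∧ ∀ x ∈ X, ∀ y ∈ X, r x = r y)
  -- A family with the most pieces works: `c` uncovered points of one colour would make a further
  -- piece.
  obtain ⟨P, hP, hmax⟩ := (univ.filter good).exists_max_image (fun P => #P)
    ⟨∅, by simp [good]⟩
  simp only [mem_filter, mem_univ, true_and] at hP hmax
  refine ⟨P, hP.1, hP.2, fun a => ?_⟩
  by_contra! h
  obtain ⟨X, hX, hXc⟩ := exists_subset_card_eq h
  have hX' : ∀ x ∈ X, x ∈ S ∧ r x = a ∧ ∀ Y ∈ P, x ∉ Y := fun x hx => by simpa using hX hx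
  have hdisj : ∀ Y ∈ P, Disjoint X Y := fun Y hY =>
    disjoint_left.mpr fun x hx => (hX' x hx).2.2 Y hY
  have hXP : X ∉ P := fun hXP => by
    obtain ⟨x, hx⟩ := card_pos.mp (hXc ▸ hc)
    exact (hX' x hx).2.2 X hXP hx
  have hgood : good (insert X P) := by
    constructor
    · intro Y hY Z hZ hYZ
      rcases mem_insert.mp hY with hY' | hY' <;> rcases mem_insert.mp hZ with hZ' | hZ'
      · exact absurd (hY'.trans hZ'.symm) hYZ
      · exact hY' ▸ hdisj Z hZ'
      · exact hZ' ▸ (hdisj Y hY').symm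
      · exact hP.1 Y hY' Z hZ' hYZ
    · intro Y hY
      rcases mem_insert.mp hY with rfl | hY
      · exact ⟨hXc, fun x hx => (hX' x hx).1,
          fun x hx y hy => (hX' x hx).2.1.trans (hX' y hy).2.1.symm⟩
      · exact hP.2 Y hY
  have := hmax _ hgood
  rw [card_insert_of_notMem hXP] at this
  omega

/-- The member of the disjoint family `P` containing `x`, and `{x}` if there is none. -/
noncomputable def partOf (P : Finset (Finset V)) (x : V) : Finset V :=
  if h : ∃ X ∈ P, x ∈ X then h.choose else {x}

lemma mem_partOf (P : Finset (Finset V)) (x : V) : x ∈ partOf P x := by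
  unfold partOf
  split_ifs with h
  · exact h.choose_spec.2
  · simp

lemma partOf_eq {P : Finset (Finset V)} (hP : ∀ X ∈ P, ∀ Y ∈ P, X ≠ Y → Disjoint X Y)
    {X : Finset V} (hX : X ∈ P) {x : V} (hx : x ∈ X) : partOf P x = X := by
  have h : ∃ X ∈ P, x ∈ X := ⟨X, hX, hx⟩
  unfold partOf
  rw [dif_pos h]
  by_contra hne
  exact disjoint_left.mp (hP _ h.choose_spec.1 _ hX hne) h.choose_spec.2 hx

lemma partOf_eq_singleton {P : Finset (Finset V)} {x : V} (h : ¬ ∃ X ∈ P, x ∈ X) :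
    partOf P x = {x} := by
  unfold partOf
  rw [dif_neg h]

lemma mem_of_partOf_eq {P : Finset (Finset V)} {X : Finset V} {x y : V}
    (hP : ∀ X ∈ P, ∀ Y ∈ P, X ≠ Y → Disjoint X Y) (hX : X ∈ P) (hx : x ∈ X)
    (h : partOf P y = partOf P x) : y ∈ X := by
  rw [partOf_eq hP hX hx] at h
  exact h ▸ mem_partOf P y

lemma eq_or_exists_of_partOf_eq {P : Finset (Finset V)} {x y : V}
    (hP : ∀ X ∈ P, ∀ Y ∈ P, X ≠ Y → Disjoint X Y) (h : partOf P y = partOf P x) :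
    y = x ∨ ∃ X ∈ P, x ∈ X ∧ y ∈ X := by
  by_cases hx : ∃ X ∈ P, x ∈ X
  · obtain ⟨X, hX, hx⟩ := hx
    exact Or.inr ⟨X, hX, hx, mem_of_partOf_eq hP hX hx h⟩
  · rw [partOf_eq_singleton hx] at h
    exact Or.inl (by simpa [h] using mem_partOf P y)

end Pieces
-- One refinement step of the regularity argument.
section RegularityStep

open Finset
open scoped Classical

variable {V ι : Type*}

/-- A family of disjoint monochromatic sets of size `c` of non-isolated vertices of `A`. -/
structure IsClusterFamily (A : SimpleGraph V) (σ : V → ι) (c : ℕ)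
    (P : Finset (Finset V)) : Prop where
  disjoint : ∀ X ∈ P, ∀ Y ∈ P, X ≠ Y → Disjoint X Y
  card_eq : ∀ X ∈ P, #X = c
  mono : ∀ X ∈ P, ∀ x ∈ X, ∀ y ∈ X, σ x = σ y
  supp : ∀ X ∈ P, ∀ x ∈ X, ∃ y, A.Adj x y

/-- The adjacency of `A` depends only on the colours. -/
def RespectsColour (A : SimpleGraph V) (σ : V → ι) : Prop :=
  ∀ x x' y y', σ x = σ x' → σ y = σ y' → A.Adj x y → A.Adj x' y'

/-- The pairs of members of `P` that are completely joined in `A` but not regular in `G`. -/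
noncomputable def irregularPairs (A G : SimpleGraph V) (ε : ℝ) (P : Finset (Finset V)) :
    Finset (Finset V × Finset V) :=
  {p ∈ P ×ˢ P | (∀ x ∈ p.1, ∀ y ∈ p.2, A.Adj x y) ∧ ¬ G.IsUniform ε p.1 p.2}

lemma mem_irregularPairs {A G : SimpleGraph V} {ε : ℝ} {P : Finset (Finset V)}
    {p : Finset V × Finset V} : p ∈ irregularPairs A G ε P ↔
      p.1 ∈ P ∧ p.2 ∈ P ∧ (∀ x ∈ p.1, ∀ y ∈ p.2, A.Adj x y) ∧ ¬ G.IsUniform ε p.1 p.2 := by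
  simp [irregularPairs, and_assoc]

lemma sum_adj_indicator (G : SimpleGraph V) (X Y : Finset V) :
    ∑ w ∈ X ×ˢ Y, (if G.Adj w.1 w.2 then (1 : ℝ) else 0) = G.edgeDensity X Y * #(X ×ˢ Y) := by
  rw [← sum_filter, sum_const, nsmul_eq_mul, mul_one, card_product, SimpleGraph.edgeDensity_def,
    SimpleGraph.interedges_def]
  rcases X.eq_empty_or_nonempty with rfl | hX
  · simp
  rcases Y.eq_empty_or_nonempty with rfl | hY
  · simp
  have h1 : (#X : ℝ) ≠ 0 := by exact_mod_cast hX.card_pos.ne'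
  have h2 : (#Y : ℝ) ≠ 0 := by exact_mod_cast hY.card_pos.ne'
  push_cast
  field_simp

lemma IsClusterFamily.eq_colour_of_partOf_eq {A : SimpleGraph V} {σ : V → ι} {c : ℕ}
    {P : Finset (Finset V)} (hP : IsClusterFamily A σ c P) {x y : V}
    (h : partOf P y = partOf P x) : σ y = σ x := by
  rcases eq_or_exists_of_partOf_eq hP.disjoint h with rfl | ⟨X, hX, hx, hy⟩
  · rfl
  · exact hP.mono X hX y hy x hx

lemma IsClusterFamily.eq_of_mem {A : SimpleGraph V} {σ : V → ι} {c : ℕ}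
    {P : Finset (Finset V)} (hP : IsClusterFamily A σ c P) {X Y : Finset V} (hX : X ∈ P)
    (hY : Y ∈ P) {x : V} (hx : x ∈ X) (hy : x ∈ Y) : X = Y := by
  by_contra h
  exact disjoint_left.mp (hP.disjoint X hX Y hY h) hx hy

/-- Disjoint members of a family inside a set of size `d` number at most `d / c`. -/
lemma IsClusterFamily.card_mul_le {A : SimpleGraph V} {σ : V → ι} {c : ℕ}
    {P Q : Finset (Finset V)} (hP : IsClusterFamily A σ c P) (hQ : Q ⊆ P) {S : Finset V}
    (hS : ∀ X ∈ Q, X ⊆ S) : #Q * c ≤ #S := by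
  calc #Q * c = ∑ X ∈ Q, #X := by
        rw [sum_congr rfl fun X hX => hP.card_eq X (hQ hX), sum_const, smul_eq_mul]
    _ = #(Q.biUnion id) := by
        exact (card_biUnion fun X hX Y hY h => hP.disjoint X (hQ hX) Y (hQ hY) h).symm
    _ ≤ #S := card_le_card (biUnion_subset.mpr hS)

/-- The label of a vertex in the refinement: its cluster and the witnesses that contain it. -/
noncomputable def witnessLabel (A G : SimpleGraph V) (ε : ℝ) (P : Finset (Finset V)) (x : V) :
    Finset V × Finset (Finset V) :=
  (partOf P x, {D ∈ P | (partOf P x, D) ∈ irregularPairs A G ε P ∧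
    x ∈ G.nonuniformWitness ε (partOf P x) D})

variable [Fintype V]

/-- The mean square density of `G` over the pairs of `A`. -/
noncomputable def pairEnergy (A G : SimpleGraph V) (P : Finset (Finset V)) : ℝ :=
  ∑ w : V × V with A.Adj w.1 w.2,
    fiberAvg (fun w : V × V => (partOf P w.1, partOf P w.2))
      (fun w => if G.Adj w.1 w.2 then (1 : ℝ) else 0) w ^ 2

/-- The non-isolated vertices of `A` of colour `a` outside the clusters. -/
noncomputable def residue (A : SimpleGraph V) (σ : V → ι) (P : Finset (Finset V)) (a : ι) :
    Finset V :=
  {x | σ x = a ∧ (∃ y, A.Adj x y) ∧ ∀ X ∈ P, x ∉ X}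

lemma pairEnergy_nonneg (A G : SimpleGraph V) (P : Finset (Finset V)) : 0 ≤ pairEnergy A G P :=
  sum_nonneg fun _ _ => sq_nonneg _

lemma pairEnergy_le (A G : SimpleGraph V) (P : Finset (Finset V)) :
    pairEnergy A G P ≤ #{w : V × V | A.Adj w.1 w.2} := by
  rw [pairEnergy, card_eq_sum_ones, Nat.cast_sum]
  refine sum_le_sum fun w _ => ?_
  rw [Nat.cast_one]
  refine pow_le_one₀ (fiberAvg_nonneg (fun w => ?_) _) (fiberAvg_le_one (fun w => ?_) _) <;>
    split_ifs <;> norm_num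

lemma card_adj_pairs_le (A : SimpleGraph V) {d : ℕ} (hd : ∀ x, #{y | A.Adj x y} ≤ d) :
    #{w : V × V | A.Adj w.1 w.2} ≤ Fintype.card V * d := by
  calc #{w : V × V | A.Adj w.1 w.2}
      = #(univ.biUnion fun x => ({y | A.Adj x y} : Finset V).image fun y => (x, y)) := by
        congr 1
        ext ⟨x, y⟩
        simp
    _ ≤ ∑ x, #(({y | A.Adj x y} : Finset V).image fun y => (x, y)) := card_biUnion_le
    _ ≤ ∑ _x : V, d := sum_le_sum fun x _ => card_image_le.trans (hd x)
    _ = Fintype.card V * d := by simp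

lemma IsClusterFamily.fiberAvg_eq {A G : SimpleGraph V} {σ : V → ι} {c : ℕ}
    {P : Finset (Finset V)} (hP : IsClusterFamily A σ c P) {X Y : Finset V} (hX : X ∈ P)
    (hY : Y ∈ P) {w : V × V} (hw : w ∈ X ×ˢ Y) :
    fiberAvg (fun w : V × V => (partOf P w.1, partOf P w.2))
      (fun w => if G.Adj w.1 w.2 then (1 : ℝ) else 0) w = G.edgeDensity X Y := by
  obtain ⟨h1, h2⟩ := mem_product.mp hw
  have hfib : ∀ z : V × V,
      (partOf P z.1, partOf P z.2) = (partOf P w.1, partOf P w.2) ↔ z ∈ X ×ˢ Y := by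
    intro z
    simp only [Prod.mk.injEq, mem_product]
    refine ⟨fun h => ⟨mem_of_partOf_eq hP.disjoint hX h1 h.1,
      mem_of_partOf_eq hP.disjoint hY h2 h.2⟩, fun h => ?_⟩
    rw [partOf_eq hP.disjoint hX h1, partOf_eq hP.disjoint hX h.1,
      partOf_eq hP.disjoint hY h2, partOf_eq hP.disjoint hY h.2]
    exact ⟨rfl, rfl⟩
  have hne : (#(X ×ˢ Y) : ℝ) ≠ 0 := by exact_mod_cast (card_pos.mpr ⟨w, hw⟩).ne'
  rw [fiberAvg_of_fiber _ hfib, sum_adj_indicator, mul_div_cancel_right₀ _ hne]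

lemma IsClusterFamily.isSaturated_adj {A : SimpleGraph V} {σ : V → ι} {c : ℕ}
    {P : Finset (Finset V)} (hP : IsClusterFamily A σ c P) (hσ : RespectsColour A σ) :
    IsSaturated (fun w : V × V => (partOf P w.1, partOf P w.2))
      ({w | A.Adj w.1 w.2} : Finset (V × V)) := by
  intro w hw z hz
  simp only [mem_filter, mem_univ, true_and, Prod.mk.injEq] at hw hz ⊢
  exact hσ _ _ _ _ (hP.eq_colour_of_partOf_eq hz.1).symm
    (hP.eq_colour_of_partOf_eq hz.2).symm hw

/-- Vertices outside `Q` are singleton fibres, so the fibres of `Q` refine those of `P`, and the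
rectangle of witnesses of an irregular pair is a union of fibres of `Q`. Such a rectangle has at
least `(ε * c) ^ 2` points and its density is off by at least `ε`, so the pair gains `ε ^ 4 * c ^
2`. The rectangles of different pairs are disjoint, and the gains add up. -/
lemma energy_increment {A G : SimpleGraph V} {σ : V → ι} {c c' : ℕ} {ε : ℝ} (hε : 0 < ε)
    (hσ : RespectsColour A σ) {P Q : Finset (Finset V)} (hP : IsClusterFamily A σ c P)
    (hc : 0 < c) (hQ : IsClusterFamily A σ c' Q)
    (hPQ : ∀ X ∈ Q, ∀ x ∈ X, ∀ y ∈ X, witnessLabel A G ε P x = witnessLabel A G ε P y) :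
    pairEnergy A G P + ε ^ 4 * (#(irregularPairs A G ε P) * (c : ℝ) ^ 2) ≤
      pairEnergy A G Q := by
  have hlab : ∀ x y, partOf Q y = partOf Q x →
      witnessLabel A G ε P y = witnessLabel A G ε P x := by
    intro x y h
    rcases eq_or_exists_of_partOf_eq hQ.disjoint h with rfl | ⟨X, hX, hx, hy⟩
    · rfl
    · exact hPQ X hX y hy x hx
  have href : ∀ w z : V × V, (partOf Q z.1, partOf Q z.2) = (partOf Q w.1, partOf Q w.2) →
      (partOf P z.1, partOf P z.2) = (partOf P w.1, partOf P w.2) := by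
    intro w z h
    simp only [Prod.mk.injEq] at h
    exact Prod.ext (Prod.ext_iff.mp (hlab _ _ h.1)).1 (Prod.ext_iff.mp (hlab _ _ h.2)).1
  have hen := energy_sub (hP.isSaturated_adj hσ) href
    (fun w => if G.Adj w.1 w.2 then (1 : ℝ) else 0)
  rw [pairEnergy, pairEnergy, hen]
  refine add_le_add le_rfl ?_
  set N : Finset V × Finset V → Finset (V × V) := fun p =>
    G.nonuniformWitness ε p.1 p.2 ×ˢ G.nonuniformWitness ε p.2 p.1 with hN
  set M := fiberAvg (fun w : V × V => (partOf Q w.1, partOf Q w.2))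
      (fun w => if G.Adj w.1 w.2 then (1 : ℝ) else 0) with hM
  have hirr := fun p => (mem_irregularPairs (A := A) (G := G) (ε := ε) (P := P) (p := p)).mp
  have hsub : ∀ p ∈ irregularPairs A G ε P, N p ⊆ p.1 ×ˢ p.2 := by
    intro p hp
    obtain ⟨-, -, -, h⟩ := hirr p hp
    exact product_subset_product (G.nonuniformWitness_subset h)
      (G.nonuniformWitness_subset fun h' => h h'.symm)
  -- The second factor of `N p` is the witness for the reversed pair, so its saturation comes from
  -- `hclosed` at `p.swap`.
  have hswap : ∀ p ∈ irregularPairs A G ε P, p.swap ∈ irregularPairs A G ε P := by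
    intro p hp
    obtain ⟨h1, h2, h3, h4⟩ := hirr p hp
    exact mem_irregularPairs.mpr ⟨h2, h1, fun x hx y hy => (h3 y hy x hx).symm, fun h' => h4 h'.symm⟩
  have hclosed : ∀ p ∈ irregularPairs A G ε P, ∀ x ∈ G.nonuniformWitness ε p.1 p.2, ∀ z,
      partOf Q z = partOf Q x → z ∈ G.nonuniformWitness ε p.1 p.2 := by
    intro p hp x hx z hz
    obtain ⟨h1, h2, -, h4⟩ := hirr p hp
    have hxp : partOf P x = p.1 :=
      partOf_eq hP.disjoint h1 (G.nonuniformWitness_subset h4 hx)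
    have hl := hlab x z hz
    have hzp : partOf P z = p.1 := (Prod.ext_iff.mp hl).1.trans hxp
    have hmem : p.2 ∈ (witnessLabel A G ε P x).2 := by
      simp only [witnessLabel, mem_filter, hxp]
      exact ⟨h2, hp, hx⟩
    rw [← hl] at hmem
    simp only [witnessLabel, mem_filter, hzp] at hmem
    exact hmem.2.2
  have hsat : ∀ p ∈ irregularPairs A G ε P,
      IsSaturated (fun w : V × V => (partOf Q w.1, partOf Q w.2)) (N p) := by
    intro p hp w hw z hz
    simp only [Prod.mk.injEq] at hz
    obtain ⟨h1, h2⟩ := mem_product.mp hw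
    exact mem_product.mpr ⟨hclosed p hp _ h1 _ hz.1, hclosed p.swap (hswap p hp) _ h2 _ hz.2⟩
  have hone : ∀ p ∈ irregularPairs A G ε P, ε ^ 4 * (c : ℝ) ^ 2 ≤
      ∑ w ∈ N p, (M w - fiberAvg (fun w : V × V => (partOf P w.1, partOf P w.2))
        (fun w => if G.Adj w.1 w.2 then (1 : ℝ) else 0) w) ^ 2 := by
    intro p hp
    obtain ⟨h1, h2, h3, h4⟩ := hirr p hp
    rw [sum_congr rfl fun w hw => by rw [hP.fiberAvg_eq h1 h2 (hsub p hp hw)]]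
    have hne : p.1 ≠ p.2 := by
      intro h
      obtain ⟨x, hx⟩ := card_pos.mp ((hP.card_eq _ h1).symm ▸ hc)
      exact A.loopless.irrefl x (h3 x hx x (h ▸ hx))
    have hspec := G.nonuniformWitness_spec hne h4
    have hc1 := G.le_card_nonuniformWitness h4
    have hc2 := G.le_card_nonuniformWitness (fun h' => h4 h'.symm : ¬ G.IsUniform ε p.2 p.1)
    rw [hP.card_eq _ h1] at hc1
    rw [hP.card_eq _ h2] at hc2
    have hcs := sq_le_card_mul_sum_sq (hsat p hp)
      (fun w => if G.Adj w.1 w.2 then (1 : ℝ) else 0) (G.edgeDensity p.1 p.2)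
    rw [hN, sum_adj_indicator, ← sub_mul, mul_pow] at hcs
    have hc0 : (0 : ℝ) < c * ε := mul_pos (by exact_mod_cast hc) hε
    have hcard : (c * ε) * (c * ε) ≤ (#(N p) : ℝ) := by
      rw [hN, card_product, Nat.cast_mul]
      exact mul_le_mul hc1 hc2 hc0.le (Nat.cast_nonneg _)
    have hpos : (0 : ℝ) < #(N p) := (mul_pos hc0 hc0).trans_le hcard
    have hsq : ε ^ 2 ≤ ((G.edgeDensity (G.nonuniformWitness ε p.1 p.2)
        (G.nonuniformWitness ε p.2 p.1) : ℝ) - G.edgeDensity p.1 p.2) ^ 2 := by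
      rw [← sq_abs (_ - _)]
      have : ε ≤ |((G.edgeDensity (G.nonuniformWitness ε p.1 p.2)
        (G.nonuniformWitness ε p.2 p.1) : ℝ) - G.edgeDensity p.1 p.2)| := by exact_mod_cast hspec
      gcongr
    have h5 : ε ^ 2 * #(N p) ≤ ∑ w ∈ N p, (M w - G.edgeDensity p.1 p.2) ^ 2 := by
      refine le_of_mul_le_mul_left ?_ hpos
      calc (#(N p) : ℝ) * (ε ^ 2 * #(N p)) = ε ^ 2 * #(N p) ^ 2 := by ring
        _ ≤ _ := mul_le_mul_of_nonneg_right hsq (sq_nonneg _)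
        _ ≤ _ := hcs
    calc ε ^ 4 * (c : ℝ) ^ 2 = ε ^ 2 * ((c * ε) * (c * ε)) := by ring
      _ ≤ ε ^ 2 * #(N p) := by gcongr
      _ ≤ _ := h5
  calc ε ^ 4 * (#(irregularPairs A G ε P) * (c : ℝ) ^ 2)
      = ∑ p ∈ irregularPairs A G ε P, ε ^ 4 * (c : ℝ) ^ 2 := by
        rw [sum_const, nsmul_eq_mul]
        ring
    _ ≤ _ := sum_le_sum hone
    _ = _ := by
        rw [← sum_biUnion]
        intro p hp q hq hpq
        refine disjoint_left.mpr fun w hw hw' => hpq ?_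
        have ha := mem_product.mp (hsub p hp hw)
        have hb := mem_product.mp (hsub q hq hw')
        exact Prod.ext (hP.eq_of_mem (hirr p hp).1 (hirr q hq).1 ha.1 hb.1)
          (hP.eq_of_mem (hirr p hp).2.1 (hirr q hq).2.1 ha.2 hb.2)
    _ ≤ _ := by
        refine sum_le_sum_of_subset_of_nonneg (fun w hw => ?_) fun _ _ _ => sq_nonneg _
        obtain ⟨p, hp, hw⟩ := mem_biUnion.mp hw
        have := mem_product.mp (hsub p hp hw)
        simpa using (hirr p hp).2.2.1 _ this.1 _ this.2

/-- One step of the regularization. -/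
lemma exists_refinement {A : SimpleGraph V} (G : SimpleGraph V) {σ : V → ι} {c c' d : ℕ} {ε : ℝ}
    (hε : 0 < ε) (hσ : RespectsColour A σ) (hd : ∀ x, #{y | A.Adj x y} ≤ d)
    {P : Finset (Finset V)} (hP : IsClusterFamily A σ c P) (hc : 0 < c) (hc' : 0 < c') :
    ∃ Q, IsClusterFamily A σ c' Q ∧
      pairEnergy A G P + ε ^ 4 * (#(irregularPairs A G ε P) * (c : ℝ) ^ 2) ≤ pairEnergy A G Q ∧
      ∀ a, #(residue A σ Q a) ≤ #(residue A σ P a) + d / c * (2 ^ (d / c) * c') := by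
  obtain ⟨Q, hdisj, hQ, hres⟩ :=
    exists_monochromatic_pieces (P.biUnion id) (witnessLabel A G ε P) hc'
  have hmem : ∀ X ∈ Q, ∀ x ∈ X, ∃ Y ∈ P, x ∈ Y := fun X hX x hx => by
    simpa using (hQ X hX).2.1 hx
  have hQ' : IsClusterFamily A σ c' Q := by
    refine ⟨hdisj, fun X hX => (hQ X hX).1, fun X hX x hx y hy => ?_, fun X hX x hx => ?_⟩
    · exact hP.eq_colour_of_partOf_eq (Prod.ext_iff.mp ((hQ X hX).2.2 x hx y hy)).1
    · obtain ⟨Y, hY, hxY⟩ := hmem X hX x hx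
      exact hP.supp Y hY x hxY
  refine ⟨Q, hQ', energy_increment hε hσ hP hc hQ' fun X hX => (hQ X hX).2.2, fun a => ?_⟩
  set Pa : Finset (Finset V) := {C ∈ P | ∀ x ∈ C, σ x = a} with hPa
  have hcover : residue A σ Q a ⊆ residue A σ P a ∪
      Pa.biUnion fun C => {x ∈ C | ∀ X ∈ Q, x ∉ X} := by
    intro x hx
    simp only [residue, mem_union, mem_filter, mem_univ, true_and, mem_biUnion] at hx ⊢
    by_cases h : ∀ X ∈ P, x ∉ X
    · exact Or.inl ⟨hx.1, hx.2.1, h⟩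
    · push Not at h
      obtain ⟨C, hC, hxC⟩ := h
      refine Or.inr ⟨C, ?_, hxC, hx.2.2⟩
      simp only [hPa, mem_filter]
      exact ⟨hC, fun y hy => (hP.mono C hC y hy x hxC).trans hx.1⟩
  -- All clusters of colour `a` lie in one neighbourhood: a neighbour `y` of one of their points is
  -- adjacent to every vertex of that colour. This is what non-isolation (`supp`) is needed for.
  have hPac : #Pa ≤ d / c := by
    rw [Nat.le_div_iff_mul_le hc]
    rcases Pa.eq_empty_or_nonempty with h | ⟨C, hC⟩
    · simp [h]
    · have hC' := (mem_filter.mp hC)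
      obtain ⟨x, hx⟩ := card_pos.mp ((hP.card_eq _ hC'.1).symm ▸ hc)
      obtain ⟨y, hy⟩ := hP.supp C hC'.1 x hx
      refine (hP.card_mul_le (filter_subset _ _) (S := {z | A.Adj y z}) ?_).trans (hd y)
      intro X hX z hz
      have hX' := mem_filter.mp hX
      simp only [mem_filter, mem_univ, true_and]
      exact (hσ x z y y ((hC'.2 x hx).trans (hX'.2 z hz).symm) rfl hy).symm
  -- A label on `C` amounts to a set of clusters completely joined to `C`. There are at most `d / c`
  -- such clusters, and each label class loses fewer than `c'` vertices.
  have hone : ∀ C ∈ Pa, #{x ∈ C | ∀ X ∈ Q, x ∉ X} ≤ 2 ^ (d / c) * c' := by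
    intro C hC
    have hCP := (mem_filter.mp hC).1
    obtain ⟨x₀, hx₀⟩ := card_pos.mp ((hP.card_eq _ hCP).symm ▸ hc)
    set N : Finset (Finset V) := {D ∈ P | ∀ x ∈ C, ∀ y ∈ D, A.Adj x y} with hN
    have hNc : #N ≤ d / c := by
      rw [Nat.le_div_iff_mul_le hc]
      refine (hP.card_mul_le (filter_subset _ _) (S := {z | A.Adj x₀ z}) ?_).trans (hd x₀)
      intro X hX z hz
      simpa using (mem_filter.mp hX).2 x₀ hx₀ z hz
    have hmaps : ∀ x ∈ ({x ∈ C | ∀ X ∈ Q, x ∉ X} : Finset V),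
        witnessLabel A G ε P x ∈ ({C} : Finset (Finset V)) ×ˢ N.powerset := by
      intro x hx
      have hxC := (mem_filter.mp hx).1
      have hpart := partOf_eq hP.disjoint hCP hxC
      rw [mem_product, mem_singleton, mem_powerset]
      refine ⟨hpart, fun D hD => ?_⟩
      simp only [witnessLabel, hpart, mem_filter, irregularPairs, mem_product] at hD
      simp only [hN, mem_filter]
      exact ⟨hD.1, hD.2.1.2.1⟩
    calc #{x ∈ C | ∀ X ∈ Q, x ∉ X}
        ≤ c' * #(({C} : Finset (Finset V)) ×ˢ N.powerset) := by
          refine card_le_mul_card_image_of_maps_to hmaps c' fun b _ => ?_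
          refine (card_le_card fun x hx => ?_).trans (hres b).le
          simp only [mem_filter, mem_biUnion, id] at hx ⊢
          exact ⟨⟨C, hCP, hx.1.1⟩, hx.2, hx.1.2⟩
      _ = 2 ^ #N * c' := by
          rw [card_product, card_singleton, card_powerset, one_mul, mul_comm]
      _ ≤ _ := by gcongr; norm_num
  calc #(residue A σ Q a) ≤ _ := card_le_card hcover
    _ ≤ _ := card_union_le _ _
    _ ≤ #(residue A σ P a) + ∑ C ∈ Pa, #{x ∈ C | ∀ X ∈ Q, x ∉ X} := by
        gcongr
        exact card_biUnion_le
    _ ≤ #(residue A σ P a) + #Pa * (2 ^ (d / c) * c') := by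
        gcongr
        exact sum_le_card_nsmul _ _ _ hone
    _ ≤ _ := by gcongr

end RegularityStep
-- Iterating the refinement: a regularity lemma at scale `k`.
section Regularity

open Finset
open scoped Classical

universe u v

/-- A family of clusters of size between `ν k` and `δ k` that leaves out at most `μ k` vertices of
each colour. -/
structure IsGoodFamily {V : Type u} {ι : Type v} [Fintype V] (A : SimpleGraph V) (σ : V → ι)
    (ν δ μ k : ℝ) (c : ℕ) (P : Finset (Finset V)) : Prop extends IsClusterFamily A σ c P where
  le_card : ν * k ≤ c
  card_le : (c : ℝ) ≤ δ * k
  residue_le : ∀ a, (#(residue A σ P a) : ℝ) ≤ μ * k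

lemma exists_nat_between {ν k : ℝ} (h : 1 ≤ ν * k) :
    ∃ c : ℕ, 0 < c ∧ ν * k ≤ c ∧ (c : ℝ) ≤ 2 * (ν * k) := by
  have h0 : 0 ≤ ν * k := zero_le_one.trans h
  refine ⟨⌈ν * k⌉₊, Nat.ceil_pos.mpr (zero_lt_one.trans_le h), Nat.le_ceil _, ?_⟩
  linarith [(Nat.ceil_lt_add_one h0).le]

lemma one_le_mul_of_ceil_lt {ν k : ℝ} (hν : 0 < ν) (h : (⌈1 / ν⌉₊ : ℝ) < k) : 1 ≤ ν * k := by
  have := (Nat.le_ceil (1 / ν)).trans h.le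
  rwa [div_le_iff₀' hν] at this

lemma exists_initial_family {δ : ℝ} (hδ : 0 < δ) :
    ∃ ν : ℝ, 0 < ν ∧ ∃ k₀ : ℕ, ∀ (V : Type u) [Fintype V] (ι : Type v) (A : SimpleGraph V)
      (σ : V → ι) (k : ℝ), (k₀ : ℝ) < k →
      ∃ c P, IsGoodFamily A σ ν δ (δ / 2) k c P := by
  refine ⟨δ / 4, by positivity, ⌈1 / (δ / 4)⌉₊, fun V _ ι A σ k hk => ?_⟩
  have hk0 : 0 < k := (Nat.cast_nonneg _).trans_lt hk
  obtain ⟨c, hc, h1, h2⟩ := exists_nat_between (one_le_mul_of_ceil_lt (by positivity) hk)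
  obtain ⟨P, hdisj, hP, hres⟩ := exists_monochromatic_pieces {x | ∃ y, A.Adj x y} σ hc
  refine ⟨c, P, ⟨hdisj, fun X hX => (hP X hX).1, fun X hX => (hP X hX).2.2,
    fun X hX x hx => by simpa using (hP X hX).2.1 hx⟩, h1, ?_, fun a => ?_⟩
  · nlinarith [mul_pos hδ hk0]
  · have : #(residue A σ P a) ≤ c := by
      refine (card_le_card fun x hx => ?_).trans (hres a).le
      simp only [residue, mem_filter, mem_univ, true_and] at hx ⊢
      exact ⟨hx.2.1, hx.1, hx.2.2⟩
    have : (#(residue A σ P a) : ℝ) ≤ c := by exact_mod_cast this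
    linarith

/-- Induction on the number of refinements: a family with few irregular pairs is kept, any other is
refined and gains a fixed amount of energy. The leftover allowances form a geometric series, so the
residue of each colour stays below `δ * k` however large `t` is. -/
lemma exists_regular_or_energetic_family {K δ ε τ : ℝ} (hK : 0 < K) (hδ : 0 < δ) (hε : 0 < ε)
    (t : ℕ) :
    ∃ ν : ℝ, 0 < ν ∧ ∃ k₀ : ℕ, ∀ (V : Type u) [Fintype V] (ι : Type v) (A G : SimpleGraph V)
      (σ : V → ι) (k : ℝ), (k₀ : ℝ) < k → RespectsColour A σ →
      (∀ x, (#{y | A.Adj x y} : ℝ) ≤ K * k) →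
      ∃ c P, IsGoodFamily A σ ν δ (δ * (1 - 1 / 2 ^ (t + 1))) k c P ∧
        ((#(irregularPairs A G ε P) : ℝ) * (c : ℝ) ^ 2 ≤ τ * k * Fintype.card V ∨
          t * (ε ^ 4 * (τ * k * Fintype.card V)) ≤ pairEnergy A G P) := by
  induction t with
  | zero =>
    obtain ⟨ν, hν, k₀, h⟩ := exists_initial_family.{u, v} hδ
    refine ⟨ν, hν, k₀, fun V _ ι A G σ k hk _ _ => ?_⟩
    obtain ⟨c, P, hP⟩ := h V ι A σ k hk
    refine ⟨c, P, ?_, Or.inr (by simpa using pairEnergy_nonneg A G P)⟩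
    convert hP using 1
    ring
  | succ t ih =>
    obtain ⟨ν, hν, k₀, h⟩ := ih
    -- `N` bounds `⌊K * k⌋₊ / c` when `c ≥ ν * k`. A refinement then loses at most `N * 2 ^ N * c'`
    -- vertices per colour with `c' ≤ 2 * ν₁ * k`, and `ν₁` is chosen to bring this below `δ / 2 ^
    -- (t + 2) * k`; `N + 1` in place of `N` keeps the denominator positive.
    set N := ⌊K / ν⌋₊ with hN
    set ν₁ : ℝ := δ / (2 ^ (t + 3) * ((N + 1) * 2 ^ N)) with hν₁
    have hν₁0 : 0 < ν₁ := by positivity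
    have hbudget : (N : ℝ) * 2 ^ N * (2 * ν₁) ≤ δ / 2 ^ (t + 2) := by
      have h1 : (N : ℝ) * 2 ^ N * (2 * ν₁) ≤ (N + 1) * 2 ^ N * (2 * ν₁) := by
        gcongr
        linarith
      refine h1.trans (le_of_eq ?_)
      rw [hν₁]
      have : ((N : ℝ) + 1) ≠ 0 := by positivity
      field_simp
      ring
    have hν₁δ : 2 * ν₁ ≤ δ := by
      rw [hν₁, mul_div_assoc', div_le_iff₀ (by positivity)]
      have h1 : (1 : ℝ) ≤ 2 ^ N := one_le_pow₀ (by norm_num)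
      have h2 : (1 : ℝ) ≤ 2 ^ t := one_le_pow₀ (by norm_num)
      have h3 : (1 : ℝ) ≤ (N + 1) * 2 ^ N := by nlinarith [(Nat.cast_nonneg N : (0 : ℝ) ≤ N)]
      have h4 : (2 : ℝ) ≤ 2 ^ (t + 3) * ((N + 1) * 2 ^ N) := by
        rw [pow_add]
        nlinarith
      nlinarith
    -- The minimum serves both outcomes: the old family kept, with its `ν`, or the refined one, with
    -- `ν₁`.
    refine ⟨min ν ν₁, lt_min hν hν₁0, max k₀ ⌈1 / ν₁⌉₊, fun V _ ι A G σ k hk hσ hA => ?_⟩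
    rw [Nat.cast_max] at hk
    have hk1 := (le_max_left _ _).trans_lt hk
    have hk2 := (le_max_right _ _).trans_lt hk
    have hk0 : 0 < k := (Nat.cast_nonneg _).trans_lt hk1
    obtain ⟨c, P, hP, hPe⟩ := h V ι A G σ k hk1 hσ hA
    have hmono : δ * (1 - 1 / 2 ^ (t + 1)) + δ / 2 ^ (t + 2) ≤
        δ * (1 - 1 / 2 ^ (t + 1 + 1)) := by
      refine le_of_eq ?_
      field_simp
      ring
    by_cases hirr : (#(irregularPairs A G ε P) : ℝ) * (c : ℝ) ^ 2 ≤ τ * k * Fintype.card V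
    · refine ⟨c, P, ⟨hP.toIsClusterFamily, ?_, hP.card_le, fun a => (hP.residue_le a).trans ?_⟩,
        Or.inl hirr⟩
      · exact (mul_le_mul_of_nonneg_right (min_le_left _ _) hk0.le).trans hP.le_card
      · have : 0 ≤ δ / 2 ^ (t + 2) := by positivity
        exact mul_le_mul_of_nonneg_right (by linarith) hk0.le
    · have hen := hPe.resolve_left hirr
      push Not at hirr
      obtain ⟨c', hc', h1, h2⟩ := exists_nat_between (one_le_mul_of_ceil_lt hν₁0 hk2)
      have hc : 0 < c := by
        have : (0 : ℝ) < c := (mul_pos hν hk0).trans_le hP.le_card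
        exact_mod_cast this
      have hd : ∀ x, #{y | A.Adj x y} ≤ ⌊K * k⌋₊ := fun x => Nat.le_floor (hA x)
      obtain ⟨Q, hQ, hQe, hQr⟩ :=
        exists_refinement G hε hσ hd hP.toIsClusterFamily hc hc'
      have hM : ⌊K * k⌋₊ / c ≤ N := by
        refine Nat.le_floor ?_
        have hc0 : (0 : ℝ) < c := by exact_mod_cast hc
        calc ((⌊K * k⌋₊ / c : ℕ) : ℝ) ≤ (⌊K * k⌋₊ : ℝ) / c := Nat.cast_div_le
          _ ≤ K * k / (ν * k) := by
              gcongr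
              · exact Nat.floor_le (by positivity)
              · exact hP.le_card
          _ = K / ν := by field_simp
      refine ⟨c', Q, ⟨hQ, ?_, ?_, fun a => ?_⟩, Or.inr ?_⟩
      · exact (mul_le_mul_of_nonneg_right (min_le_right _ _) hk0.le).trans h1
      · calc (c' : ℝ) ≤ 2 * ν₁ * k := by linarith
          _ ≤ δ * k := by gcongr
      · have h3 : #(residue A σ Q a) ≤ #(residue A σ P a) + N * (2 ^ N * c') := by
          refine (hQr a).trans ?_
          gcongr
          norm_num
        have h4 : (#(residue A σ Q a) : ℝ) ≤ #(residue A σ P a) + N * (2 ^ N * c') := by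
          exact_mod_cast h3
        calc (#(residue A σ Q a) : ℝ) ≤ _ := h4
          _ ≤ δ * (1 - 1 / 2 ^ (t + 1)) * k + N * (2 ^ N * (2 * (ν₁ * k))) := by
              gcongr
              exact hP.residue_le a
          _ = (δ * (1 - 1 / 2 ^ (t + 1)) + N * 2 ^ N * (2 * ν₁)) * k := by ring
          _ ≤ (δ * (1 - 1 / 2 ^ (t + 1)) + δ / 2 ^ (t + 2)) * k := by gcongr
          _ ≤ _ := by gcongr
      · refine le_trans ?_ hQe
        have : ε ^ 4 * (τ * k * Fintype.card V) ≤
            ε ^ 4 * (#(irregularPairs A G ε P) * (c : ℝ) ^ 2) := by gcongr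
        push_cast
        linarith

/-- A regularity lemma for graphs in which every vertex has to be considered together with few
others. -/
theorem exists_regular_family {K δ ε τ : ℝ} (hK : 0 < K) (hδ : 0 < δ) (hε : 0 < ε)
    (hτ : 0 < τ) :
    ∃ ν : ℝ, 0 < ν ∧ ∃ k₀ : ℕ, ∀ (V : Type u) [Fintype V] [Nonempty V] (ι : Type v)
      (A G : SimpleGraph V) (σ : V → ι) (k : ℝ), (k₀ : ℝ) < k → RespectsColour A σ →
      (∀ x, (#{y | A.Adj x y} : ℝ) ≤ K * k) →
      ∃ c P, IsGoodFamily A σ ν δ δ k c P ∧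
        (#(irregularPairs A G ε P) : ℝ) * (c : ℝ) ^ 2 ≤ τ * k * Fintype.card V := by
  -- The energy never exceeds `K * k * n`, so `T` gains of `ε ^ 4 * τ * k * n` are impossible.
  obtain ⟨T, hT⟩ := exists_nat_gt (K / (ε ^ 4 * τ))
  obtain ⟨ν, hν, k₀, h⟩ := exists_regular_or_energetic_family.{u, v} (τ := τ) hK hδ hε T
  refine ⟨ν, hν, k₀, fun V _ _ ι A G σ k hk hσ hA => ?_⟩
  have hk0 : 0 < k := (Nat.cast_nonneg _).trans_lt hk
  obtain ⟨c, P, hP, hPe⟩ := h V ι A G σ k hk hσ hA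
  refine ⟨c, P, ⟨hP.toIsClusterFamily, hP.le_card, hP.card_le,
    fun a => (hP.residue_le a).trans ?_⟩, hPe.resolve_right fun hen => ?_⟩
  · have : (0 : ℝ) ≤ 1 / 2 ^ (T + 1) := by positivity
    gcongr
    nlinarith
  · have h1 := card_adj_pairs_le A (d := ⌊K * k⌋₊) fun x => Nat.le_floor (hA x)
    have h2 : (#{w : V × V | A.Adj w.1 w.2} : ℝ) ≤ Fintype.card V * (K * k) := by
      calc (#{w : V × V | A.Adj w.1 w.2} : ℝ) ≤ Fintype.card V * ⌊K * k⌋₊ := by exact_mod_cast h1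
        _ ≤ _ := by
          gcongr
          exact Nat.floor_le (by positivity)
    have h3 := hen.trans ((pairEnergy_le A G P).trans h2)
    have hn : (0 : ℝ) < Fintype.card V := by exact_mod_cast Fintype.card_pos
    rw [div_lt_iff₀ (by positivity)] at hT
    have : K * (k * Fintype.card V) < T * (ε ^ 4 * τ) * (k * Fintype.card V) := by gcongr
    linarith

end Regularity
-- Peeling and a gap in the degree sequence.
section Degrees

open Finset
open scoped Classical

variable {V : Type*} [Fintype V]

lemma ncard_incident_le (G : SimpleGraph V) (M : Finset V) :
    {e ∈ G.edgeSet | ∃ v ∈ M, v ∈ e}.ncard ≤ ∑ v ∈ M, (G.neighborSet v).ncard := by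
  have h : {e ∈ G.edgeSet | ∃ v ∈ M, v ∈ e} ⊆ ⋃ v ∈ M, (fun w => s(v, w)) '' G.neighborSet v := by
    rintro e ⟨he, v, hv, hve⟩
    obtain ⟨w, rfl⟩ := hve
    exact Set.mem_biUnion hv ⟨w, he, rfl⟩
  calc _ ≤ _ := Set.ncard_le_ncard h (Set.toFinite _)
    _ ≤ ∑ v ∈ M, ((fun w => s(v, w)) '' G.neighborSet v).ncard :=
        Finset.set_ncard_biUnion_le _ _
    _ ≤ _ := sum_le_sum fun v _ => Set.ncard_image_le (Set.toFinite _)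

lemma sum_ncard_neighborSet (G : SimpleGraph V) :
    ∑ v, (G.neighborSet v).ncard = 2 * G.edgeSet.ncard := by
  have h := G.sum_degrees_eq_twice_card_edges
  rw [Set.ncard_eq_toFinset_card', ← SimpleGraph.edgeFinset, ← h]
  refine sum_congr rfl fun v _ => ?_
  rw [Set.ncard_eq_toFinset_card', ← SimpleGraph.neighborFinset_def, SimpleGraph.card_neighborFinset_eq_degree]

/-- Removing vertices of small degree one by one. -/
lemma exists_peeling (G : SimpleGraph V) (L : Set V) {c : ℝ} (hc : 0 ≤ c) (T : Finset V) :
    ∃ S ⊆ T, (∀ v ∈ S, c < ({w | G.Adj v w ∧ (w ∈ L ∨ w ∈ S)}.ncard : ℝ)) ∧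
      ({e ∈ G.edgeSet | (∀ v ∈ e, v ∈ L ∨ v ∈ T) ∧ ¬ ∀ v ∈ e, v ∈ L ∨ v ∈ S}.ncard : ℝ) ≤
        c * #T := by
  induction T using Finset.strongInduction with
  | H T ih =>
    by_cases h : ∀ v ∈ T, c < ({w | G.Adj v w ∧ (w ∈ L ∨ w ∈ T)}.ncard : ℝ)
    · refine ⟨T, Subset.rfl, h, ?_⟩
      have : {e ∈ G.edgeSet | (∀ v ∈ e, v ∈ L ∨ v ∈ T) ∧ ¬ ∀ v ∈ e, v ∈ L ∨ v ∈ T} = ∅ := by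
        ext e
        simp only [Set.mem_ofPred_eq, Set.mem_empty_iff_false, iff_false]
        tauto
      rw [this]
      simpa using mul_nonneg hc (Nat.cast_nonneg _)
    -- A vertex `v` of low degree is discarded; the at most `c` edges lost are charged to `v`.
    · push Not at h
      obtain ⟨v, hv, hvc⟩ := h
      obtain ⟨S, hS, hdeg, hcard⟩ := ih (T.erase v) (erase_ssubset hv)
      refine ⟨S, hS.trans (erase_subset _ _), hdeg, ?_⟩
      have hsub : {e ∈ G.edgeSet | (∀ v ∈ e, v ∈ L ∨ v ∈ T) ∧ ¬ ∀ v ∈ e, v ∈ L ∨ v ∈ S} ⊆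
          {e ∈ G.edgeSet | (∀ u ∈ e, u ∈ L ∨ u ∈ T.erase v) ∧ ¬ ∀ v ∈ e, v ∈ L ∨ v ∈ S} ∪
            (fun w => s(v, w)) '' {w | G.Adj v w ∧ (w ∈ L ∨ w ∈ T)} := by
        rintro e ⟨he, he1, he2⟩
        by_cases hve : v ∈ e
        · obtain ⟨w, rfl⟩ := hve
          exact Or.inr ⟨w, ⟨he, he1 w (Sym2.mem_mk_right _ _)⟩, rfl⟩
        · refine Or.inl ⟨he, fun u hu => (he1 u hu).imp_right fun huT => ?_, he2⟩
          exact mem_erase.mpr ⟨fun h => hve (h ▸ hu), huT⟩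
      have h1 := (Set.ncard_le_ncard hsub (Set.toFinite _)).trans (Set.ncard_union_le _ _)
      have h2 : ((fun w => s(v, w)) '' {w | G.Adj v w ∧ (w ∈ L ∨ w ∈ T)}).ncard ≤
          {w | G.Adj v w ∧ (w ∈ L ∨ w ∈ T)}.ncard := Set.ncard_image_le (Set.toFinite _)
      have h3 : (#(T.erase v) : ℝ) + 1 = #T := by exact_mod_cast card_erase_add_one hv
      have h4 := (Nat.cast_le (α := ℝ)).mpr (h1.trans (Nat.add_le_add_left h2 _))
      push_cast at h4
      rw [← h3]
      linarith

/-- The spanning subgraph of all edges of `G` inside `X`. -/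
def edgesWithin (G : SimpleGraph V) (X : Set V) : SimpleGraph V where
  Adj u v := G.Adj u v ∧ u ∈ X ∧ v ∈ X
  symm := ⟨fun _ _ h => ⟨h.1.symm, h.2.2, h.2.1⟩⟩
  loopless := ⟨fun v h => G.loopless.irrefl v h.1⟩

lemma mul_card_eq_of_avgDegree {G : SimpleGraph V} {k : ℝ} (hk : avgDegree G = k) (hk0 : 0 < k) :
    k * Fintype.card V = 2 * G.edgeSet.ncard := by
  rw [avgDegree, Nat.card_eq_fintype_card] at hk
  have : (Fintype.card V : ℝ) ≠ 0 := by
    intro h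
    rw [h, div_zero] at hk
    exact hk0.ne hk
  rw [← hk]
  field_simp

lemma le_of_ratio {Ω : ℕ → ℝ} {η : ℝ} (hη4 : η ≤ 4) (hpos : ∀ j, 1 ≤ j → 0 < Ω j)
    (hratio : ∀ j, 1 ≤ j → Ω j / Ω (j + 1) ≤ η / 4) {i j : ℕ} (hi : 1 ≤ i) (hij : i ≤ j) :
    Ω i ≤ Ω j := by
  induction j, hij using Nat.le_induction with
  | base => exact le_rfl
  | succ j hij ih =>
    refine ih.trans ?_
    have h1 := hratio j (hi.trans hij)
    have h2 := hpos (j + 1) (by omega)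
    rw [div_le_iff₀ h2] at h1
    nlinarith

/-- The sum of the degrees that lie in `[Ω j * k, Ω (j + 1) * k)`. -/
noncomputable def levelSum (G : SimpleGraph V) (Ω : ℕ → ℝ) (k : ℝ) (j : ℕ) : ℝ :=
  ∑ v with Ω j * k ≤ ((G.neighborSet v).ncard : ℝ) ∧ ((G.neighborSet v).ncard : ℝ) < Ω (j + 1) * k,
    ((G.neighborSet v).ncard : ℝ)

/-- The half-open degree ranges are disjoint, so each vertex is counted at most once. The shift `s`
lets two consecutive levels be summed together. -/
lemma sum_levelSum_le (G : SimpleGraph V) {Ω : ℕ → ℝ} {k : ℝ} (hk : 0 ≤ k)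
    (hmono : ∀ i j, 1 ≤ i → i ≤ j → Ω i ≤ Ω j) (L s : ℕ) :
    ∑ j ∈ Icc 1 L, levelSum G Ω k (j + s) ≤ ∑ v, ((G.neighborSet v).ncard : ℝ) := by
  simp only [levelSum, sum_filter]
  rw [sum_comm]
  refine sum_le_sum fun v _ => ?_
  rw [← sum_filter, sum_const, nsmul_eq_mul]
  refine mul_le_of_le_one_left (Nat.cast_nonneg _) ?_
  rw [Nat.cast_le_one, card_le_one]
  have key : ∀ i ∈ Icc 1 L, ∀ j ∈ Icc 1 L, i < j →
      ((G.neighborSet v).ncard : ℝ) < Ω (i + s + 1) * k →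
      ¬ Ω (j + s) * k ≤ ((G.neighborSet v).ncard : ℝ) := by
    intro i hi j hj hij h1 h2
    have := mul_le_mul_of_nonneg_right (hmono (i + s + 1) (j + s) (by omega) (by omega)) hk
    linarith
  intro i hi j hj
  rw [mem_filter] at hi hj
  rcases lt_trichotomy i j with h | h | h
  · exact absurd hj.2.1 (key i hi.1 j hj.1 h hi.2.2)
  · exact h
  · exact absurd hi.2.1 (key j hj.1 i hi.1 h hj.2.2)

/-- A graph has a large subgraph with a gap in its degree sequence. -/
lemma exists_degree_gap (G : SimpleGraph V) {η k : ℝ} (hη : 0 < η) (hη4 : η ≤ 4)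
    {Ω : ℕ → ℝ} (hpos : ∀ j, 1 ≤ j → 0 < Ω j) (hratio : ∀ j, 1 ≤ j → Ω j / Ω (j + 1) ≤ η / 4)
    (hk : avgDegree G = k) (hk0 : 0 < k) :
    ∃ i : ℕ, 1 ≤ i ∧ (i : ℝ) ≤ 4 / η ∧ ∃ G' : SimpleGraph V, G' ≤ G ∧
      ((G.edgeSet \ G'.edgeSet).ncard : ℝ) ≤ η * k * Fintype.card V ∧
      ∃ H : Set V, (∀ v ∈ H, Ω (i + 1) * k ≤ ((G'.neighborSet v).ncard : ℝ)) ∧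
        ∀ v, v ∉ H → ((G'.neighborSet v).ncard : ℝ) ≤ Ω i * k := by
  have hkn := mul_card_eq_of_avgDegree hk hk0
  have hkn0 : 0 ≤ k * Fintype.card V := by positivity
  -- As `e(G) = k * n / 2`, for `η ≥ 1 / 2` all edges may be deleted.
  rcases le_or_gt (1 / 2) η with hη2 | hη2
  · refine ⟨1, le_rfl, ?_, ⊥, bot_le, ?_, ∅, by simp, fun v _ => ?_⟩
    · rw [Nat.cast_one, le_div_iff₀ hη]
      linarith
    · rw [SimpleGraph.edgeSet_bot, Set.sdiff_empty]
      nlinarith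
    · have : (⊥ : SimpleGraph V).neighborSet v = ∅ := by
        ext w
        simp
      rw [this]
      simpa using (mul_pos (hpos 1 le_rfl) hk0).le
  have hmono : ∀ i j, 1 ≤ i → i ≤ j → Ω i ≤ Ω j := fun i j => le_of_ratio hη4 hpos hratio
  have hsum : ∑ v, ((G.neighborSet v).ncard : ℝ) = k * Fintype.card V := by
    rw [hkn]
    exact_mod_cast sum_ncard_neighborSet G
  set L := ⌊4 / η⌋₊ with hL
  have hL1 : 4 / η - 1 < L := by linarith [Nat.lt_floor_add_one (4 / η)]
  have hLη : 3.5 ≤ L * η := by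
    have h1 : 4 / η * η = 4 := by field_simp
    nlinarith
  have hL0 : (0 : ℝ) < L := by
    by_contra! h
    nlinarith
  have hL0' : 1 ≤ L := by exact_mod_cast hL0
  -- Two adjacent levels must be light. Peeling costs `Ω (i + 1) * k` per vertex of `T`, and this is
  -- at most `η / 4` of its degree only because that degree is at least `Ω (i + 2) * k`. From `L * η
  -- ≥ 3.5` the levels cost at most `3 / 4 * η * k * n`, leaving `η / 4` for the peeling.
  obtain ⟨i, hi, hsmall⟩ : ∃ i ∈ Icc 1 L, levelSum G Ω k (i + 0) + levelSum G Ω k (i + 1) ≤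
      2 * (k * Fintype.card V) / L := by
    refine exists_le_of_sum_le ⟨1, by simp [hL0']⟩ ?_
    rw [sum_add_distrib, sum_const, Nat.card_Icc, nsmul_eq_mul, Nat.add_sub_cancel,
      mul_div_cancel₀ _ hL0.ne']
    have h1 := sum_levelSum_le G hk0.le hmono L 0
    have h2 := sum_levelSum_le G hk0.le hmono L 1
    linarith
  obtain ⟨hi1, hiL⟩ := mem_Icc.mp hi
  set deg : V → ℝ := fun v => ((G.neighborSet v).ncard : ℝ) with hdeg
  set Low : Set V := {v | deg v < Ω i * k} with hLow
  set M : Finset V := {v | Ω i * k ≤ deg v ∧ deg v < Ω (i + 2) * k} with hM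
  set T : Finset V := {v | Ω (i + 2) * k ≤ deg v} with hT
  obtain ⟨S, hST, hS, hpeel⟩ := exists_peeling G Low (c := Ω (i + 1) * k)
    (mul_pos (hpos (i + 1) (by omega)) hk0).le T
  have hle : edgesWithin G (Low ∪ S) ≤ G := fun u v h => h.1
  have hMsum : ∑ v ∈ M, deg v ≤ levelSum G Ω k (i + 0) + levelSum G Ω k (i + 1) := by
    have hsub : M ⊆ ({v | Ω i * k ≤ deg v ∧ deg v < Ω (i + 1) * k} : Finset V) ∪
        ({v | Ω (i + 1) * k ≤ deg v ∧ deg v < Ω (i + 1 + 1) * k} : Finset V) := by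
      intro v hv
      simp only [hM, mem_union, mem_filter, mem_univ, true_and] at hv ⊢
      rcases lt_or_ge (deg v) (Ω (i + 1) * k) with h | h
      · exact Or.inl ⟨hv.1, h⟩
      · exact Or.inr ⟨h, hv.2⟩
    refine (sum_le_sum_of_subset_of_nonneg hsub fun _ _ _ => Nat.cast_nonneg _).trans ?_
    have h := sum_union_inter (s₁ := ({v | Ω i * k ≤ deg v ∧ deg v < Ω (i + 1) * k} : Finset V))
      (s₂ := ({v | Ω (i + 1) * k ≤ deg v ∧ deg v < Ω (i + 1 + 1) * k} : Finset V)) (f := deg)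
    rw [levelSum, levelSum, add_zero, ← h]
    exact le_add_of_nonneg_right (sum_nonneg fun _ _ => Nat.cast_nonneg _)
  have hTsum : Ω (i + 1) * k * #T ≤ η / 4 * (k * Fintype.card V) := by
    have h1 := hratio (i + 1) (by omega)
    rw [div_le_iff₀ (hpos (i + 1 + 1) (by omega))] at h1
    calc Ω (i + 1) * k * #T ≤ η / 4 * Ω (i + 2) * k * #T := by gcongr
      _ = η / 4 * ∑ v ∈ T, Ω (i + 2) * k := by
          rw [sum_const, nsmul_eq_mul]
          ring
      _ ≤ η / 4 * ∑ v ∈ T, deg v := by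
          gcongr with v hv
          exact (mem_filter.mp hv).2
      _ ≤ η / 4 * ∑ v, deg v := by
          refine mul_le_mul_of_nonneg_left ?_ (by positivity)
          exact sum_le_sum_of_subset_of_nonneg (subset_univ T) fun v _ _ => Nat.cast_nonneg _
      _ = _ := by rw [hsum]
  refine ⟨i, hi1, ?_, edgesWithin G (Low ∪ S), hle, ?_, S, fun v hv => ?_, fun v hv => ?_⟩
  · exact (Nat.cast_le.mpr hiL).trans (Nat.floor_le (by positivity))
  · have hsub : G.edgeSet \ (edgesWithin G (Low ∪ S)).edgeSet ⊆
        {e ∈ G.edgeSet | ∃ v ∈ M, v ∈ e} ∪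
        {e ∈ G.edgeSet | (∀ v ∈ e, v ∈ Low ∨ v ∈ T) ∧ ¬ ∀ v ∈ e, v ∈ Low ∨ v ∈ S} := by
      rintro e ⟨he, he'⟩
      by_cases h : ∃ v ∈ M, v ∈ e
      · exact Or.inl ⟨he, h⟩
      · refine Or.inr ⟨he, fun v hv => ?_, fun hall => he' ?_⟩
        · push Not at h
          have hvM : v ∉ M := fun hvM => h v hvM hv
          simp only [hM, hT, hLow, mem_filter, mem_univ, true_and, Set.mem_ofPred_eq] at hvM ⊢
          by_contra! hcon
          exact hvM ⟨hcon.1, hcon.2⟩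
        · induction e with
          | _ x y =>
            exact ⟨he, hall x (Sym2.mem_mk_left _ _), hall y (Sym2.mem_mk_right _ _)⟩
    have h1 := (Set.ncard_le_ncard hsub (Set.toFinite _)).trans (Set.ncard_union_le _ _)
    have h2 : (({e ∈ G.edgeSet | ∃ v ∈ M, v ∈ e}).ncard : ℝ) ≤ ∑ v ∈ M, deg v := by
      simp only [hdeg]
      exact_mod_cast ncard_incident_le G M
    have h3 := (Nat.cast_le (α := ℝ)).mpr h1
    push_cast at h3
    have h4 : 2 * (k * Fintype.card V) / L ≤ 3 / 4 * η * (k * Fintype.card V) := by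
      rw [div_le_iff₀ hL0]
      nlinarith
    linarith
  · refine (hS v hv).le.trans (Nat.cast_le.mpr (Set.ncard_le_ncard ?_ (Set.toFinite _)))
    rintro w ⟨hw, hw'⟩
    exact ⟨hw, Or.inr hv, hw'⟩
  · by_cases hvL : v ∈ Low
    · exact (Nat.cast_le.mpr (Set.ncard_le_ncard (fun w hw => hle hw) (Set.toFinite _))).trans
        (le_of_lt hvL)
    · have : (edgesWithin G (Low ∪ S)).neighborSet v = ∅ := by
        ext w
        simp only [SimpleGraph.mem_neighborSet, Set.mem_empty_iff_false, iff_false]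
        exact fun h => h.2.1.elim hvL hv
      rw [this]
      simpa using (mul_pos (hpos i hi1) hk0).le

end Degrees
-- Dense spots, the graph of their sides, and avoiding sets.
section Spots

open Finset
open scoped Classical

variable {V : Type*} {G : SimpleGraph V}

lemma spotGraph_adj {𝒟 : Set (BipSubgraph G)} {u v : V} :
    (spotGraph 𝒟).Adj u v ↔ ∃ D ∈ 𝒟, D.graph.Adj u v := by
  simp [spotGraph]

lemma mem_edgeSet_spotGraph {𝒟 : Set (BipSubgraph G)} {e : Sym2 V} :
    e ∈ (spotGraph 𝒟).edgeSet ↔ ∃ D ∈ 𝒟, e ∈ D.graph.edgeSet := by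
  induction e with
  | _ x y => simp only [SimpleGraph.Subgraph.mem_edgeSet, spotGraph_adj]

/-- The bipartite subgraph `D` with an edge between the two sides added. -/
def BipSubgraph.addEdge (D : BipSubgraph G) {u w : V} (hu : u ∈ D.left) (hw : w ∈ D.right)
    (h : G.Adj u w) : BipSubgraph G where
  left := D.left
  right := D.right
  graph := D.graph ⊔ G.subgraphOfAdj h
  verts_eq := by
    rw [SimpleGraph.Subgraph.verts_sup, D.verts_eq, SimpleGraph.subgraphOfAdj_verts,
      Set.union_eq_left]
    rintro x (rfl | rfl)
    · exact Or.inl hu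
    · exact Or.inr hw
  bipartite := by
    refine ⟨D.bipartite.disjoint, fun x y hxy => ?_⟩
    simp only [SimpleGraph.Subgraph.spanningCoe_adj, SimpleGraph.Subgraph.sup_adj,
      SimpleGraph.subgraphOfAdj_adj] at hxy
    rcases hxy with hxy | hxy
    · exact D.bipartite.mem_of_adj hxy
    · rcases Sym2.eq_iff.mp hxy with ⟨rfl, rfl⟩ | ⟨rfl, rfl⟩
      · exact Or.inl ⟨hu, hw⟩
      · exact Or.inr ⟨hw, hu⟩

lemma mem_edgeSet_addEdge {D : BipSubgraph G} {u w : V} {hu : u ∈ D.left} {hw : w ∈ D.right}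
    {h : G.Adj u w} {e : Sym2 V} :
    e ∈ (D.addEdge hu hw h).graph.edgeSet ↔ e ∈ D.graph.edgeSet ∨ e = s(u, w) := by
  simp [BipSubgraph.addEdge, or_comm]

lemma BipSubgraph.disjoint_sides (D : BipSubgraph G) : Disjoint D.left D.right :=
  Finset.disjoint_coe.mp D.bipartite.disjoint

lemma BipSubgraph.mem_verts {D : BipSubgraph G} {v : V} :
    v ∈ D.graph.verts ↔ v ∈ D.left ∨ v ∈ D.right := by
  rw [D.verts_eq]
  simp

lemma density_mono {H H' : SimpleGraph V} (h : H ≤ H') (U W : Finset V) :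
    density H U W ≤ density H' U W := by
  unfold density
  rw [SimpleGraph.edgeDensity_def, SimpleGraph.edgeDensity_def]
  have : #(H.interedges U W) ≤ #(H'.interedges U W) := card_le_card fun x hx => by
    rw [SimpleGraph.mem_interedges_iff] at hx ⊢
    exact ⟨hx.1, hx.2.1, h hx.2.2⟩
  push_cast
  gcongr

lemma density_mul (H : SimpleGraph V) (U W : Finset V) :
    density H U W * (#U * #W) = #(H.interedges U W) := by
  rcases U.eq_empty_or_nonempty with rfl | hU
  · simp
  rcases W.eq_empty_or_nonempty with rfl | hW
  · simp [SimpleGraph.interedges_def]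
  have h1 : (#U : ℝ) ≠ 0 := by exact_mod_cast hU.card_pos.ne'
  have h2 : (#W : ℝ) ≠ 0 := by exact_mod_cast hW.card_pos.ne'
  rw [density, SimpleGraph.edgeDensity_def]
  push_cast
  field_simp

lemma density_comm (H : SimpleGraph V) (U W : Finset V) : density H U W = density H W U := by
  unfold density
  rw [SimpleGraph.edgeDensity_comm]

/-- Two vertices are joined if they are on different sides of a member of `𝒟`. -/
def sidesGraph (𝒟 : Set (BipSubgraph G)) : SimpleGraph V where
  Adj x y := ∃ D ∈ 𝒟, (x ∈ D.left ∧ y ∈ D.right) ∨ (x ∈ D.right ∧ y ∈ D.left)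
  symm := ⟨fun _ _ ⟨D, hD, h⟩ => ⟨D, hD, h.symm.imp And.symm And.symm⟩⟩
  loopless := ⟨fun _ ⟨D, _, h⟩ => h.elim
    (fun h => Finset.disjoint_left.mp D.disjoint_sides h.1 h.2)
    (fun h => Finset.disjoint_left.mp D.disjoint_sides h.2 h.1)⟩

lemma spotGraph_le_sidesGraph {𝒟 : Set (BipSubgraph G)} {x y : V}
    (h : (spotGraph 𝒟).Adj x y) : (sidesGraph 𝒟).Adj x y := by
  obtain ⟨D, hD, hxy⟩ := spotGraph_adj.mp h
  exact ⟨D, hD, D.bipartite.mem_of_adj hxy⟩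

/-- The sides of the members of `𝒟` containing `x`, and membership of `x` in `X`. -/
noncomputable def spotColour (𝒟 : Set (BipSubgraph G)) (X : Set V) (x : V) :
    (Set (BipSubgraph G) × Set (BipSubgraph G)) × Prop :=
  (({D ∈ 𝒟 | x ∈ D.left}, {D ∈ 𝒟 | x ∈ D.right}), x ∈ X)

lemma spotColour_eq_iff {𝒟 : Set (BipSubgraph G)} {X : Set V} {x y : V} :
    spotColour 𝒟 X x = spotColour 𝒟 X y ↔
      (∀ D ∈ 𝒟, (x ∈ D.left ↔ y ∈ D.left) ∧ (x ∈ D.right ↔ y ∈ D.right)) ∧ (x ∈ X ↔ y ∈ X) := by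
  simp only [spotColour, Prod.mk.injEq, Set.ext_iff, eq_iff_iff, Set.mem_ofPred_eq]
  constructor
  · rintro ⟨⟨h1, h2⟩, h3⟩
    refine ⟨fun D hD => ⟨?_, ?_⟩, h3⟩
    · simpa [hD] using h1 D
    · simpa [hD] using h2 D
  · rintro ⟨h1, h3⟩
    refine ⟨⟨fun D => and_congr_right fun hD => (h1 D hD).1,
      fun D => and_congr_right fun hD => (h1 D hD).2⟩, h3⟩

lemma respectsColour_sidesGraph (𝒟 : Set (BipSubgraph G)) (X : Set V) :
    RespectsColour (sidesGraph 𝒟) (spotColour 𝒟 X) := by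
  rintro x x' y y' hx hy ⟨D, hD, h⟩
  have h1 := (spotColour_eq_iff.mp hx).1 D hD
  have h2 := (spotColour_eq_iff.mp hy).1 D hD
  exact ⟨D, hD, by rwa [← h1.1, ← h1.2, ← h2.1, ← h2.2]⟩

variable [Fintype V]

instance : Finite (BipSubgraph G) := by
  refine Finite.of_injective (β := Finset V × Finset V × Set V × (V → V → Prop))
    (fun D => (D.left, D.right, D.graph.verts, D.graph.Adj)) ?_
  rintro ⟨l, r, g, h1, h2⟩ ⟨l', r', g', h1', h2'⟩ h
  simp only [Prod.mk.injEq] at h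
  obtain ⟨rfl, rfl, h3, h4⟩ := h
  obtain rfl : g = g' := SimpleGraph.Subgraph.ext h3 h4
  rfl

lemma IsDenseSpot.addEdge {B : G.Subgraph} {m γ : ℝ} {D : BipSubgraph G}
    (hD : IsDenseSpot B m γ D) {u w : V} (hu : u ∈ D.left) (hw : w ∈ D.right) (h : B.Adj u w) :
    IsDenseSpot B m γ (D.addEdge hu hw h.adj_sub) := by
  obtain ⟨h1, ⟨e, he⟩, h3, h4⟩ := hD
  have hle : D.graph ≤ (D.addEdge hu hw h.adj_sub).graph := le_sup_left
  refine ⟨sup_le h1 ?_, ⟨e, mem_edgeSet_addEdge.mpr (Or.inl he)⟩,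
    h3.trans_le (density_mono (fun x y hxy => hle.2 hxy) _ _), fun v hv => ?_⟩
  · exact SimpleGraph.subgraphOfAdj_le_of_adj B h
  · have hv' : v ∈ D.graph.verts := by
      rw [D.verts_eq]
      rwa [(D.addEdge hu hw h.adj_sub).verts_eq] at hv
    exact (h4 v hv').trans_le (Nat.cast_le.mpr
      (Set.ncard_le_ncard (fun x hx => hle.2 hx) (Set.toFinite _)))

/-- Edge-disjoint dense spots in `B` that cover all edges of `B` between their sides. -/
structure IsSpotFamily (B : G.Subgraph) (m γ : ℝ) (𝒟 : Set (BipSubgraph G)) : Prop where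
  dense : ∀ D ∈ 𝒟, IsDenseSpot B m γ D
  edgeDisjoint : ∀ D ∈ 𝒟, ∀ D' ∈ 𝒟, D ≠ D' → Disjoint D.graph.edgeSet D'.graph.edgeSet
  cover : ∀ D ∈ 𝒟, ∀ u ∈ D.left, ∀ w ∈ D.right, B.Adj u w → (spotGraph 𝒟).Adj u w

/-- One extremal choice, of the most covered edges, gives both properties: an uncovered edge across
a spot could be added to that spot, and a dense spot in the remainder could be added to the family.
-/
lemma exists_maximal_spotFamily (B : G.Subgraph) (m γ : ℝ) :
    ∃ 𝒟, IsSpotFamily B m γ 𝒟 ∧ IsNowhereDense (B.deleteEdges (spotGraph 𝒟).edgeSet) m γ := by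
  let good : Set (Set (BipSubgraph G)) := {𝒟 | (∀ D ∈ 𝒟, IsDenseSpot B m γ D) ∧
    ∀ D ∈ 𝒟, ∀ D' ∈ 𝒟, D ≠ D' → Disjoint D.graph.edgeSet D'.graph.edgeSet}
  obtain ⟨𝒟, ⟨hdense, hdisj⟩, hmax⟩ := Set.exists_max_image good
    (fun 𝒟 => (spotGraph 𝒟).edgeSet.ncard) (Set.toFinite _) ⟨∅, by simp [good]⟩
  have hno : ∀ 𝒟' ∈ good, ∀ e, e ∉ (spotGraph 𝒟).edgeSet → e ∈ (spotGraph 𝒟').edgeSet →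
      ¬ (spotGraph 𝒟).edgeSet ⊆ (spotGraph 𝒟').edgeSet := by
    intro 𝒟' h𝒟' e he he' hsub
    exact (hmax 𝒟' h𝒟').not_gt (Set.ncard_lt_ncard
      (Set.ssubset_iff_of_subset hsub |>.mpr ⟨e, he', he⟩) (Set.toFinite _))
  refine ⟨𝒟, ⟨hdense, hdisj, fun D hD u hu w hw huw => ?_⟩, fun D hD => ?_⟩
  · by_contra hcon
    have hne : s(u, w) ∉ (spotGraph 𝒟).edgeSet := hcon
    refine hno (insert (D.addEdge hu hw huw.adj_sub) (𝒟 \ {D})) ⟨?_, ?_⟩ s(u, w) hne ?_ ?_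
    · rintro D' (rfl | hD')
      · exact (hdense D hD).addEdge hu hw huw
      · exact hdense D' hD'.1
    · have key : ∀ D' ∈ 𝒟 \ {D}, Disjoint (D.addEdge hu hw huw.adj_sub).graph.edgeSet
          D'.graph.edgeSet := by
        intro D' hD'
        refine Set.disjoint_left.mpr fun e he he' => ?_
        rcases mem_edgeSet_addEdge.mp he with he | rfl
        · exact Set.disjoint_left.mp (hdisj D hD D' hD'.1 fun h => hD'.2 h.symm) he he'
        · exact hne (mem_edgeSet_spotGraph.mpr ⟨D', hD'.1, he'⟩)
      rintro D₁ (h₁ | h₁) D₂ (h₂ | h₂) h12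
      · exact absurd (h₁.trans h₂.symm) h12
      · exact h₁ ▸ key D₂ h₂
      · exact h₂ ▸ (key D₁ h₁).symm
      · exact hdisj D₁ h₁.1 D₂ h₂.1 h12
    · exact mem_edgeSet_spotGraph.mpr ⟨_, Or.inl rfl, mem_edgeSet_addEdge.mpr (Or.inr rfl)⟩
    · intro e he
      obtain ⟨D', hD', he'⟩ := mem_edgeSet_spotGraph.mp he
      by_cases h : D' = D
      · exact mem_edgeSet_spotGraph.mpr
          ⟨_, Or.inl rfl, mem_edgeSet_addEdge.mpr (Or.inl (h ▸ he'))⟩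
      · exact mem_edgeSet_spotGraph.mpr ⟨D', Or.inr ⟨hD', h⟩, he'⟩
  · obtain ⟨e, he⟩ := hD.2.1
    have hedge : ∀ e ∈ D.graph.edgeSet, e ∉ (spotGraph 𝒟).edgeSet := by
      intro e he
      induction e with
      | _ x y =>
        have h := hD.1.2 he
        rw [SimpleGraph.Subgraph.deleteEdges_adj] at h
        exact h.2
    refine hno (insert D 𝒟) ⟨?_, ?_⟩ e (hedge e he)
      (mem_edgeSet_spotGraph.mpr ⟨D, Or.inl rfl, he⟩) ?_
    · rintro D' (rfl | hD')
      · exact ⟨hD.1.trans (SimpleGraph.Subgraph.deleteEdges_le _), hD.2⟩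
      · exact hdense D' hD'
    · have key : ∀ D' ∈ 𝒟, Disjoint D.graph.edgeSet D'.graph.edgeSet := fun D' hD' =>
        Set.disjoint_left.mpr fun e he he' =>
          hedge e he (mem_edgeSet_spotGraph.mpr ⟨D', hD', he'⟩)
      rintro D₁ (h₁ | h₁) D₂ (h₂ | h₂) h12
      · exact absurd (h₁.trans h₂.symm) h12
      · exact h₁ ▸ key D₂ h₂
      · exact h₂ ▸ (key D₁ h₁).symm
      · exact hdisj D₁ h₁ D₂ h₂ h12
    · intro e he
      obtain ⟨D', hD', he'⟩ := mem_edgeSet_spotGraph.mp he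
      exact mem_edgeSet_spotGraph.mpr ⟨D', Or.inr hD', he'⟩

lemma card_interedges_le_of_degree_le {H : SimpleGraph V} {d : ℝ}
    (hd : ∀ v, ((H.neighborSet v).ncard : ℝ) ≤ d) (U W : Finset V) :
    (#(H.interedges U W) : ℝ) ≤ #U * d := by
  have hsub : H.interedges U W ⊆
      U.biUnion fun x => (H.neighborSet x).toFinset.image fun y => (x, y) := by
    intro z hz
    rw [SimpleGraph.mem_interedges_iff] at hz
    simp only [mem_biUnion, mem_image, Set.mem_toFinset, SimpleGraph.mem_neighborSet]
    exact ⟨z.1, hz.1, z.2, hz.2.2, rfl⟩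
  have h := (card_le_card hsub).trans card_biUnion_le
  calc (#(H.interedges U W) : ℝ)
      ≤ ∑ x ∈ U, (#((H.neighborSet x).toFinset.image fun y => (x, y)) : ℝ) := by
        exact_mod_cast h
    _ ≤ ∑ _x ∈ U, d := sum_le_sum fun x _ => by
        refine le_trans (Nat.cast_le.mpr card_image_le) ?_
        rw [← Set.ncard_eq_toFinset_card']
        exact hd x
    _ = #U * d := by rw [sum_const, nsmul_eq_mul]

/-- Count edges: `γ * |U| * |W| ≤ e(U, W) ≤ |U| * d`, then cancel `|U|`, which is positive because
the density is. -/
lemma mul_card_le_of_lt_density {H : SimpleGraph V} {d γ : ℝ}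
    (hd : ∀ v, ((H.neighborSet v).ncard : ℝ) ≤ d) (hγ : 0 < γ) {U W : Finset V}
    (h : γ < density H U W) : γ * #W ≤ d := by
  have hU : (0 : ℝ) < #U := by
    rcases U.eq_empty_or_nonempty with rfl | hU
    · simp [density] at h
      exact absurd h hγ.not_gt
    · exact_mod_cast hU.card_pos
  have h1 := card_interedges_le_of_degree_le hd U W
  rw [← density_mul] at h1
  refine le_of_mul_le_mul_left ?_ hU
  calc (#U : ℝ) * (γ * #W) = γ * (#U * #W) := by ring
    _ ≤ density H U W * (#U * #W) := by gcongr
    _ ≤ _ := h1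

namespace IsDenseSpot

variable {B : G.Subgraph} {m γ d : ℝ} {D : BipSubgraph G}

lemma degree_le (hD : IsDenseSpot B m γ D) (hd : ∀ v, ((B.neighborSet v).ncard : ℝ) ≤ d) (v : V) :
    ((D.graph.spanningCoe.neighborSet v).ncard : ℝ) ≤ d :=
  (Nat.cast_le.mpr (Set.ncard_le_ncard (fun _ hw => hD.1.2 hw) (Set.toFinite _))).trans (hd v)

lemma card_right_le (hD : IsDenseSpot B m γ D) (hγ : 0 < γ)
    (hd : ∀ v, ((B.neighborSet v).ncard : ℝ) ≤ d) : γ * #D.right ≤ d :=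
  mul_card_le_of_lt_density (hD.degree_le hd) hγ hD.2.2.1

lemma card_left_le (hD : IsDenseSpot B m γ D) (hγ : 0 < γ)
    (hd : ∀ v, ((B.neighborSet v).ncard : ℝ) ≤ d) : γ * #D.left ≤ d :=
  mul_card_le_of_lt_density (hD.degree_le hd) hγ ((density_comm _ _ _) ▸ hD.2.2.1)

lemma mul_card_mul_card_le (hD : IsDenseSpot B m γ D) :
    γ * (#D.left * #D.right) ≤ (D.graph.edgeSet.ncard : ℝ) := by
  calc γ * ((#D.left : ℝ) * #D.right) ≤ density D.graph.spanningCoe D.left D.right *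
        (#D.left * #D.right) := by
        gcongr
        exact hD.2.2.1.le
    _ = #(D.graph.spanningCoe.interedges D.left D.right) := density_mul _ _ _
    _ ≤ _ := by
        rw [Set.ncard_eq_toFinset_card', Nat.cast_le]
        refine card_le_card_of_injOn (fun z => s(z.1, z.2)) (fun z hz => ?_) ?_
        · rw [mem_coe, SimpleGraph.mem_interedges_iff] at hz
          simpa using hz.2.2
        · intro z hz z' hz' h
          rw [mem_coe, SimpleGraph.mem_interedges_iff] at hz hz'
          rcases Sym2.eq_iff.mp h with ⟨h1, h2⟩ | ⟨h1, h2⟩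
          · exact Prod.ext h1 h2
          · exact absurd (h1 ▸ hz'.2.1) (Finset.disjoint_left.mp D.disjoint_sides hz.1)

end IsDenseSpot

namespace IsSpotFamily

variable {B : G.Subgraph} {m γ d : ℝ} {𝒟 : Set (BipSubgraph G)}

/-- Few spots contain a given vertex. -/
lemma mul_card_le (h : IsSpotFamily B m γ 𝒟) (hd : ∀ v, ((B.neighborSet v).ncard : ℝ) ≤ d)
    {F : Finset (BipSubgraph G)} (hF : ∀ D ∈ F, D ∈ 𝒟) {v : V}
    (hv : ∀ D ∈ F, v ∈ D.graph.verts) : m * #F ≤ d := by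
  have hdisj : ∀ D ∈ F, ∀ D' ∈ F, D ≠ D' →
      Disjoint (D.graph.neighborSet v).toFinset (D'.graph.neighborSet v).toFinset := by
    intro D hD D' hD' hne
    refine Finset.disjoint_left.mpr fun w hw hw' => ?_
    rw [Set.mem_toFinset] at hw hw'
    exact Set.disjoint_left.mp (h.edgeDisjoint D (hF D hD) D' (hF D' hD') hne)
      (SimpleGraph.Subgraph.mem_edgeSet.mpr hw) (SimpleGraph.Subgraph.mem_edgeSet.mpr hw')
  calc m * #F = ∑ D ∈ F, m := by rw [sum_const, nsmul_eq_mul, mul_comm]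
    _ ≤ ∑ D ∈ F, (#(D.graph.neighborSet v).toFinset : ℝ) := sum_le_sum fun D hD => by
        rw [← Set.ncard_eq_toFinset_card']
        exact ((h.dense D (hF D hD)).2.2.2 v (hv D hD)).le
    _ = #(F.biUnion fun D => (D.graph.neighborSet v).toFinset) := by
        rw [card_biUnion hdisj, Nat.cast_sum]
    _ ≤ ((B.neighborSet v).ncard : ℝ) := by
        rw [Set.ncard_eq_toFinset_card', Nat.cast_le]
        refine card_le_card (biUnion_subset.mpr fun D hD w hw => ?_)
        rw [Set.mem_toFinset] at hw ⊢
        exact (h.dense D (hF D hD)).1.2 hw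
    _ ≤ d := hd v

/-- At most `d / m` spots contain `x`, and the opposite side of each has at most `d / γ` vertices.
-/
lemma sidesGraph_degree_le (h : IsSpotFamily B m γ 𝒟) (hm : 0 < m) (hγ : 0 < γ)
    (hd : ∀ v, ((B.neighborSet v).ncard : ℝ) ≤ d) (x : V) :
    (#{y | (sidesGraph 𝒟).Adj x y} : ℝ) ≤ d / m * (d / γ) := by
  have hfin : 𝒟.Finite := Set.toFinite _
  set F : Finset (BipSubgraph G) := {D ∈ hfin.toFinset | x ∈ D.graph.verts} with hF
  have hF𝒟 : ∀ D ∈ F, D ∈ 𝒟 := fun D hD => by simpa using (mem_filter.mp hD).1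
  have hsub : ({y | (sidesGraph 𝒟).Adj x y} : Finset V) ⊆
      F.biUnion fun D => if x ∈ D.left then D.right else D.left := by
    intro y hy
    obtain ⟨D, hD, hxy⟩ := (mem_filter.mp hy).2
    refine mem_biUnion.mpr ⟨D, ?_, ?_⟩
    · simp only [hF, mem_filter, Set.Finite.mem_toFinset, BipSubgraph.mem_verts]
      exact ⟨hD, hxy.imp And.left And.left⟩
    · rcases hxy with hxy | hxy
      · rw [if_pos hxy.1]
        exact hxy.2
      · rw [if_neg (Finset.disjoint_right.mp D.disjoint_sides hxy.1)]
        exact hxy.2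
  have hd0 : 0 ≤ d := (Nat.cast_nonneg _).trans (hd x)
  calc (#{y | (sidesGraph 𝒟).Adj x y} : ℝ)
      ≤ ∑ D ∈ F, (#(if x ∈ D.left then D.right else D.left) : ℝ) := by
        exact_mod_cast (card_le_card hsub).trans card_biUnion_le
    _ ≤ ∑ _D ∈ F, d / γ := by
        refine sum_le_sum fun D hD => ?_
        rw [le_div_iff₀' hγ]
        have hDs := h.dense D (hF𝒟 D hD)
        split_ifs
        · exact hDs.card_right_le hγ hd
        · exact hDs.card_left_le hγ hd
    _ = #F * (d / γ) := by rw [sum_const, nsmul_eq_mul]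
    _ ≤ d / m * (d / γ) := by
        gcongr
        rw [le_div_iff₀' hm]
        exact h.mul_card_le hd hF𝒟 fun D hD => (mem_filter.mp hD).2

/-- Each spot has at least a `γ` fraction of its cross pairs as edges, and the spots are
edge-disjoint; the factor 2 counts ordered pairs. -/
lemma mul_card_sidesGraph_le (h : IsSpotFamily B m γ 𝒟) (hγ : 0 < γ) :
    γ * (#{w : V × V | (sidesGraph 𝒟).Adj w.1 w.2} : ℝ) ≤ 2 * (B.edgeSet.ncard : ℝ) := by
  have hfin : 𝒟.Finite := Set.toFinite _
  have hsub : ({w : V × V | (sidesGraph 𝒟).Adj w.1 w.2} : Finset (V × V)) ⊆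
      hfin.toFinset.biUnion fun D => D.left ×ˢ D.right ∪ D.right ×ˢ D.left := by
    intro w hw
    obtain ⟨D, hD, hxy⟩ := (mem_filter.mp hw).2
    exact mem_biUnion.mpr ⟨D, by simpa using hD, by simpa using hxy⟩
  have hone : ∀ D ∈ hfin.toFinset,
      γ * (#(D.left ×ˢ D.right ∪ D.right ×ˢ D.left) : ℝ) ≤
        2 * (#D.graph.edgeSet.toFinset : ℝ) := by
    intro D hD
    have h1 := (h.dense D (by simpa using hD)).mul_card_mul_card_le
    have h2 : (#(D.left ×ˢ D.right ∪ D.right ×ˢ D.left) : ℝ) ≤ 2 * (#D.left * #D.right) := by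
      have := card_union_le (D.left ×ˢ D.right) (D.right ×ˢ D.left)
      rw [card_product, card_product] at this
      have h3 := (Nat.cast_le (α := ℝ)).mpr this
      push_cast at h3
      linarith
    rw [← Set.ncard_eq_toFinset_card']
    nlinarith
  calc γ * (#{w : V × V | (sidesGraph 𝒟).Adj w.1 w.2} : ℝ)
      ≤ γ * ∑ D ∈ hfin.toFinset, (#(D.left ×ˢ D.right ∪ D.right ×ˢ D.left) : ℝ) := by
        gcongr
        exact_mod_cast (card_le_card hsub).trans card_biUnion_le
    _ ≤ ∑ D ∈ hfin.toFinset, 2 * (#D.graph.edgeSet.toFinset : ℝ) := by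
        rw [mul_sum]
        exact sum_le_sum hone
    _ = 2 * (#(hfin.toFinset.biUnion fun D => D.graph.edgeSet.toFinset) : ℝ) := by
        rw [← mul_sum, card_biUnion, Nat.cast_sum]
        intro D hD D' hD' hne
        exact Set.disjoint_toFinset.mpr
          (h.edgeDisjoint D (hfin.mem_toFinset.mp hD) D' (hfin.mem_toFinset.mp hD') hne)
    _ ≤ _ := by
        gcongr
        rw [Set.ncard_eq_toFinset_card']
        refine card_le_card (biUnion_subset.mpr fun D hD e he => ?_)
        rw [Set.mem_toFinset] at he ⊢
        exact SimpleGraph.Subgraph.edgeSet_mono (h.dense D (by simpa using hD)).1 he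

end IsSpotFamily

/-- A set with few vertices of each colour is avoiding. -/
lemma IsSpotFamily.isAvoiding {B : G.Subgraph} {γ Ω k Λ δ ε : ℝ} {𝒟 : Set (BipSubgraph G)}
    (h : IsSpotFamily B (γ * k) γ 𝒟) (hγ : 0 < γ) (hk : 0 < k) (hΩ : 0 < Ω) (hδ : 0 < δ)
    (hd : ∀ v, ((B.neighborSet v).ncard : ℝ) ≤ Ω * k)
    (hδε : 2 * 4 ^ ⌊Λ * Ω / γ ^ 3⌋₊ * δ ≤ ε) (B' : G.Subgraph) (X : Set V)
    {P : Finset (Finset V)}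
    (hP : ∀ a, (#(residue (sidesGraph 𝒟) (spotColour 𝒟 X) P a) : ℝ) ≤ δ * k) :
    IsAvoiding B' Λ ε γ k 𝒟 {x | (∃ y, (sidesGraph 𝒟).Adj x y) ∧ ∀ C ∈ P, x ∉ C} := by
  refine ⟨?_, fun U _ hU => ?_⟩
  · rintro x ⟨⟨y, D, hD, hxy⟩, -⟩
    exact ⟨D, hD, BipSubgraph.mem_verts.mpr (hxy.imp And.left And.left)⟩
  have hfin : 𝒟.Finite := Set.toFinite _
  set F : Finset (BipSubgraph G) :=
    {D ∈ hfin.toFinset | γ ^ 2 * k < ((U ∩ D.graph.verts).ncard : ℝ)} with hF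
  have hF𝒟 : ∀ D ∈ F, D ∈ 𝒟 := fun D hD => by simpa using (mem_filter.mp hD).1
  -- Count incidences between `U` and `F`: each heavy spot contains more than `γ ^ 2 * k` vertices
  -- of `U`, and each of the at most `Λ * k` vertices of `U` lies in at most `Ω / γ` spots.
  have hFcard : #F ≤ ⌊Λ * Ω / γ ^ 3⌋₊ := by
    refine Nat.le_floor ?_
    have hdc : ∑ D ∈ F, ((U ∩ D.graph.verts).ncard : ℝ) =
        ∑ v ∈ U.toFinset, (#{D ∈ F | v ∈ D.graph.verts} : ℝ) := by
      have := sum_card_bipartiteAbove_eq_sum_card_bipartiteBelow (s := F) (t := U.toFinset)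
        (fun D v => v ∈ D.graph.verts)
      simp only [bipartiteAbove, bipartiteBelow] at this
      rw [← Nat.cast_sum, ← Nat.cast_sum, ← this]
      congr 1
      refine sum_congr rfl fun D _ => ?_
      rw [Set.ncard_eq_toFinset_card']
      congr 1
      ext v
      simp
    have h1 : γ ^ 2 * k * #F ≤ ∑ D ∈ F, ((U ∩ D.graph.verts).ncard : ℝ) := by
      rw [mul_comm, ← nsmul_eq_mul]
      exact card_nsmul_le_sum _ _ _ fun D hD => (mem_filter.mp hD).2.le
    have h2 : ∑ v ∈ U.toFinset, (#{D ∈ F | v ∈ D.graph.verts} : ℝ) ≤ Λ * k * (Ω / γ) := by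
      calc _ ≤ ∑ v ∈ U.toFinset, Ω / γ := by
            refine sum_le_sum fun v _ => ?_
            have h3 := h.mul_card_le hd (F := {D ∈ F | v ∈ D.graph.verts}) (v := v)
              (fun D hD => hF𝒟 D (mem_filter.mp hD).1) (fun D hD => (mem_filter.mp hD).2)
            rw [le_div_iff₀' hγ]
            refine le_of_mul_le_mul_left ?_ hk
            linarith
        _ = (U.ncard : ℝ) * (Ω / γ) := by
            rw [sum_const, nsmul_eq_mul, Set.ncard_eq_toFinset_card']
        _ ≤ _ := by gcongr
    rw [le_div_iff₀ (by positivity)]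
    have h3 : γ ^ 2 * k * #F ≤ Λ * k * (Ω / γ) := by linarith
    have h4 : Λ * k * (Ω / γ) * γ = Λ * k * Ω := by field_simp
    refine le_of_mul_le_mul_left ?_ hk
    nlinarith
  set Z := {v ∈ {x | (∃ y, (sidesGraph 𝒟).Adj x y) ∧ ∀ C ∈ P, x ∉ C} |
    ¬ ∃ D ∈ 𝒟, v ∈ D.graph.verts ∧ ((U ∩ D.graph.verts).ncard : ℝ) ≤ γ ^ 2 * k} with hZ
  -- All spots through a bad vertex are in `F`, so its colour consists of two subsets of `F` and a
  -- truth value; hence the count `2 * 4 ^ #F`.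
  set labels : Finset ((Set (BipSubgraph G) × Set (BipSubgraph G)) × Prop) :=
    ((F.powerset.image fun S : Finset (BipSubgraph G) => (S : Set (BipSubgraph G))) ×ˢ
      (F.powerset.image fun S : Finset (BipSubgraph G) => (S : Set (BipSubgraph G)))) ×ˢ univ with hlabels
  have hlabcard : #labels ≤ 2 * 4 ^ ⌊Λ * Ω / γ ^ 3⌋₊ := by
    have h1 : #(F.powerset.image fun S : Finset (BipSubgraph G) => (S : Set (BipSubgraph G))) ≤ 2 ^ #F :=
      card_image_le.trans (card_powerset F).le
    rw [hlabels, card_product, card_product, card_univ, Fintype.card_prop]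
    calc _ ≤ 2 ^ #F * 2 ^ #F * 2 := by gcongr
      _ = 2 * 4 ^ #F := by
          rw [← mul_pow]
          ring
      _ ≤ _ := by
          gcongr
          norm_num
  have hcover : Z.toFinset ⊆
      labels.biUnion fun a => residue (sidesGraph 𝒟) (spotColour 𝒟 X) P a := by
    intro v hv
    rw [Set.mem_toFinset] at hv
    obtain ⟨⟨hv1, hv2⟩, hv3⟩ := hv
    push Not at hv3
    have hsides : ∀ p : BipSubgraph G → Prop, (∀ D, p D → v ∈ D.graph.verts) →
        {D ∈ 𝒟 | p D} ∈ F.powerset.image fun S : Finset (BipSubgraph G) => (S : Set (BipSubgraph G)) := by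
      intro p hp
      refine mem_image.mpr ⟨{D ∈ F | p D}, mem_powerset.mpr (filter_subset _ _), ?_⟩
      ext D
      simp only [coe_filter, Set.mem_ofPred_eq, hF, mem_filter, Set.Finite.mem_toFinset]
      exact ⟨fun h => ⟨h.1.1, h.2⟩, fun h => ⟨⟨h.1, hv3 D h.1 (hp D h.2)⟩, h.2⟩⟩
    refine mem_biUnion.mpr ⟨spotColour 𝒟 X v, ?_, ?_⟩
    · refine mem_product.mpr ⟨mem_product.mpr ⟨hsides _ fun D hD => ?_, hsides _ fun D hD => ?_⟩,
        mem_univ _⟩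
      · exact BipSubgraph.mem_verts.mpr (Or.inl hD)
      · exact BipSubgraph.mem_verts.mpr (Or.inr hD)
    · simp only [residue, mem_filter, mem_univ, true_and]
      exact ⟨hv1, hv2⟩
  calc (Z.ncard : ℝ) = #Z.toFinset := by rw [Set.ncard_eq_toFinset_card']
    _ ≤ ∑ a ∈ labels, (#(residue (sidesGraph 𝒟) (spotColour 𝒟 X) P a) : ℝ) := by
        exact_mod_cast (card_le_card hcover).trans card_biUnion_le
    _ ≤ #labels * (δ * k) := by
        rw [← nsmul_eq_mul]
        exact sum_le_card_nsmul _ _ _ fun a _ => hP a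
    _ ≤ (2 * 4 ^ ⌊Λ * Ω / γ ^ 3⌋₊ : ℕ) * (δ * k) := by gcongr
    _ = 2 * 4 ^ ⌊Λ * Ω / γ ^ 3⌋₊ * δ * k := by
        push_cast
        ring
    _ ≤ ε * k := by gcongr

end Spots
-- Assembling the bounded and the sparse decomposition.
section Decomposition

open Finset
open scoped Classical

universe u

lemma IsRegularPair.symm {V : Type*} {G : SimpleGraph V} {ε : ℝ} {U W : Finset V}
    (h : IsRegularPair G ε U W) : IsRegularPair G ε W U :=
  ⟨h.1.symm, h.2.symm⟩

/-- The union of the regular pairs of density at least `γ ^ 2` among the pairs of clusters that are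
completely joined in `A`. -/
def regularGraph {V : Type*} {G : SimpleGraph V} (B : G.Subgraph) (A : SimpleGraph V) (ε γ : ℝ)
    (P : Finset (Finset V)) : G.Subgraph where
  verts := {v | ∃ C ∈ P, v ∈ C}
  Adj x y := ∃ C ∈ P, ∃ C' ∈ P, x ∈ C ∧ y ∈ C' ∧ B.Adj x y ∧ (∀ a ∈ C, ∀ b ∈ C', A.Adj a b) ∧
    IsRegularPair B.spanningCoe ε C C' ∧ γ ^ 2 ≤ density B.spanningCoe C C'
  adj_sub := fun ⟨_, _, _, _, _, _, h, _⟩ => h.adj_sub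
  edge_vert := fun ⟨C, hC, _, _, hx, _⟩ => ⟨C, hC, hx⟩
  symm := ⟨fun _ _ ⟨C, hC, C', hC', hx, hy, h, hA, hr, hd⟩ =>
    ⟨C', hC', C, hC, hy, hx, h.symm, fun a ha b hb => (hA b hb a ha).symm, hr.symm,
      density_comm B.spanningCoe C C' ▸ hd⟩⟩

/-- The edges in completely joined pairs of clusters of density less than `t` are few. -/
lemma IsClusterFamily.card_sparse_le {V ι : Type*} [Fintype V] {A H : SimpleGraph V} {σ : V → ι}
    {c : ℕ} {P : Finset (Finset V)} (hP : IsClusterFamily A σ c P) {t : ℝ} (ht : 0 ≤ t)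
    {Q : Finset (Finset V × Finset V)}
    (hQ : ∀ p ∈ Q, p.1 ∈ P ∧ p.2 ∈ P ∧ (∀ x ∈ p.1, ∀ y ∈ p.2, A.Adj x y) ∧
      density H p.1 p.2 < t) :
    (#(Q.biUnion fun p => H.interedges p.1 p.2) : ℝ) ≤
      t * #{w : V × V | A.Adj w.1 w.2} := by
  have hdisj : ∀ p ∈ Q, ∀ q ∈ Q, p ≠ q → Disjoint (p.1 ×ˢ p.2) (q.1 ×ˢ q.2) := by
    intro p hp q hq hpq
    refine disjoint_left.mpr fun w hw hw' => hpq ?_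
    have ha := mem_product.mp hw
    have hb := mem_product.mp hw'
    exact Prod.ext (hP.eq_of_mem (hQ p hp).1 (hQ q hq).1 ha.1 hb.1)
      (hP.eq_of_mem (hQ p hp).2.1 (hQ q hq).2.1 ha.2 hb.2)
  calc (#(Q.biUnion fun p => H.interedges p.1 p.2) : ℝ)
      ≤ ∑ p ∈ Q, (#(H.interedges p.1 p.2) : ℝ) := by exact_mod_cast card_biUnion_le
    _ ≤ ∑ p ∈ Q, t * #(p.1 ×ˢ p.2) := sum_le_sum fun p hp => by
        rw [← density_mul, card_product, Nat.cast_mul]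
        gcongr
        exact (hQ p hp).2.2.2.le
    _ = t * #(Q.biUnion fun p => p.1 ×ˢ p.2) := by
        rw [← mul_sum, card_biUnion hdisj, Nat.cast_sum]
    _ ≤ _ := by
        gcongr
        intro w hw
        obtain ⟨p, hp, hw⟩ := mem_biUnion.mp hw
        have := mem_product.mp hw
        simpa using (hQ p hp).2.2.1 _ this.1 _ this.2

/-- Peeling with no protected vertices secures the minimum degree; a dense spot in the surviving
induced subgraph would be one in `B₀`. -/
lemma exists_nowhereDense_part {V : Type*} [Fintype V] {G : SimpleGraph V} (B₀ : G.Subgraph)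
    {m γ c : ℝ} (hc : 0 ≤ c) (h : IsNowhereDense B₀ m γ) :
    ∃ X ≤ B₀, IsNowhereDense X m γ ∧ (∀ v ∈ X.verts, c < ((X.neighborSet v).ncard : ℝ)) ∧
      ((B₀.edgeSet \ X.edgeSet).ncard : ℝ) ≤ c * Fintype.card V := by
  obtain ⟨S, hS, hdeg, hcard⟩ := exists_peeling B₀.spanningCoe ∅ hc B₀.verts.toFinset
  have hS' : (S : Set V) ⊆ B₀.verts := fun v hv => Set.mem_toFinset.mp (hS hv)
  have hle : B₀.induce S ≤ B₀ := ⟨hS', fun v w h => h.2.2⟩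
  refine ⟨B₀.induce S, hle, fun D hD => h D ⟨hD.1.trans hle, hD.2⟩, fun v hv => ?_, ?_⟩
  · refine (hdeg v hv).trans_le (Nat.cast_le.mpr (Set.ncard_le_ncard ?_ (Set.toFinite _)))
    rintro w ⟨hw, hw'⟩
    exact ⟨hv, hw'.resolve_left id, hw⟩
  · refine le_trans (Nat.cast_le.mpr (Set.ncard_le_ncard ?_ (Set.toFinite _))) (hcard.trans ?_)
    · rintro e ⟨he, he'⟩
      induction e with
      | _ x y =>
        have he1 : B₀.Adj x y := he
        refine ⟨he, fun v hv => Or.inr (Set.mem_toFinset.mpr ?_), fun hall => he' ?_⟩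
        · rcases Sym2.mem_iff.mp hv with rfl | rfl
          · exact he1.fst_mem
          · exact he1.snd_mem
        · exact ⟨(hall x (Sym2.mem_mk_left _ _)).resolve_left id,
            (hall y (Sym2.mem_mk_right _ _)).resolve_left id, he1⟩
    · gcongr
      exact card_le_univ _

/-- The edges captured by a bounded decomposition. -/
def boundedCaptured {V : Type*} {G : SimpleGraph V} (clusters : Set (Finset V))
    (𝒟 : Set (BipSubgraph G)) (Greg Gexp : G.Subgraph) (E : Set V) : Set (Sym2 V) :=
  Greg.edgeSet ∪ Gexp.edgeSet ∪
    {e | ∃ x ∈ E, ∃ y, (y ∈ E ∨ ∃ C ∈ clusters, y ∈ C) ∧ (spotGraph 𝒟).Adj x y ∧ e = s(x, y)}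

section Assembly

variable {V : Type*} [Fintype V] {G : SimpleGraph V} {B X : G.Subgraph}
  {k Λ γ ε ν ρ δ : ℝ} {𝒟 : Set (BipSubgraph G)} {c : ℕ} {P : Finset (Finset V)}

/-- The colours do the work: vertices of one cluster lie on the same sides of all spots and agree
about membership in `X.verts`. The regular pairs avoid `X` because every edge of `B` across a spot
is covered by the spots, whereas `X` contains no covered edge. -/
lemma IsGoodFamily.isBoundedDecomposition (h𝒟 : IsSpotFamily B (γ * k) γ 𝒟)
    (hX : X ≤ B.deleteEdges (spotGraph 𝒟).edgeSet) (hXnd : IsNowhereDense X (γ * k) γ)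
    (hXdeg : ∀ v ∈ X.verts, ρ * k < ((X.neighborSet v).ncard : ℝ))
    (hP : IsGoodFamily (sidesGraph 𝒟) (spotColour 𝒟 X.verts) ν ε δ k c P)
    (hc : 0 < c) {E : Set V} (hE : E = {x | (∃ y, (sidesGraph 𝒟).Adj x y) ∧ ∀ C ∈ P, x ∉ C})
    (havoid : IsAvoiding B Λ ε γ k 𝒟 E)
    {s : ℕ} {part : Fin s → Set V} {j : Fin s} (hpart : B.verts ⊆ part j) :
    IsBoundedDecomposition B part k Λ γ ε ν ρ (P : Set (Finset V)) 𝒟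
      (regularGraph B (sidesGraph 𝒟) ε γ P) X E := by
  have hXadj : ∀ {x y}, X.Adj x y → ¬ (spotGraph 𝒟).Adj x y := by
    intro x y h
    have h := hX.2 h
    rw [SimpleGraph.Subgraph.deleteEdges_adj] at h
    exact h.2
  have hverts : ∀ x y, (sidesGraph 𝒟).Adj x y → x ∈ B.verts := by
    rintro x y ⟨D, hD, hxy⟩
    exact (h𝒟.dense D hD).1.1 (BipSubgraph.mem_verts.mpr (hxy.imp And.left And.left))
  have hcover : ∀ x y, (sidesGraph 𝒟).Adj x y → B.Adj x y → (spotGraph 𝒟).Adj x y := by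
    rintro x y ⟨D, hD, hxy | hxy⟩ h
    · exact h𝒟.cover D hD x hxy.1 y hxy.2 h
    · exact (h𝒟.cover D hD y hxy.2 x hxy.1 h.symm).symm
  have hcolour : ∀ C ∈ P, ∀ x ∈ C, ∀ y ∈ C, (∀ D ∈ 𝒟, (x ∈ D.left ↔ y ∈ D.left) ∧
      (x ∈ D.right ↔ y ∈ D.right)) ∧ (x ∈ X.verts ↔ y ∈ X.verts) := fun C hC x hx y hy =>
    spotColour_eq_iff.mp (hP.mono C hC x hx y hy)
  have hCB : ∀ C ∈ P, (C : Set V) ⊆ B.verts := by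
    intro C hC x hx
    obtain ⟨y, hy⟩ := hP.supp C hC x hx
    exact hverts x y hy
  have hne : ∀ C ∈ P, ∃ x, x ∈ C := fun C hC =>
    card_pos.mp ((hP.card_eq C hC).symm ▸ hc)
  refine
    { exp_le := hX.trans (SimpleGraph.Subgraph.deleteEdges_le _)
      exp_nowhereDense := hXnd
      exp_minDegree := hXdeg
      clusters_subset := hCB
      clusters_disjoint := hP.disjoint
      reg_le := ⟨?_, ?_⟩
      reg_verts := by simp [regularGraph]
      reg_pairs := ?_
      cluster_card_eq := fun C hC C' hC' => (hP.card_eq C hC).trans (hP.card_eq C' hC').symm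
      cluster_card_ge := fun C hC => (hP.card_eq C hC).symm ▸ hP.le_card
      cluster_card_le := fun C hC => (hP.card_eq C hC).symm ▸ hP.card_le
      spots_dense := fun D hD => ⟨⟨(h𝒟.dense D hD).1.1, ?_⟩, (h𝒟.dense D hD).2⟩
      spots_edgeDisjoint := h𝒟.edgeDisjoint
      spots_cover := h𝒟.cover
      reg_in_spot := ?_
      cluster_part := ?_
      cluster_spot := ?_
      avoiding_subset := ?_
      avoiding := havoid }
  · rintro v ⟨C, hC, hv⟩
    exact hCB C hC hv
  · rintro x y ⟨C, hC, C', hC', hx, hy, h, hA, -⟩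
    rw [SimpleGraph.Subgraph.deleteEdges_adj]
    exact ⟨h, fun hxy => hXadj hxy (hcover x y (hA x hx y hy) h)⟩
  · rintro x y ⟨C, hC, C', hC', hx, hy, h, hA, hr, hd⟩
    refine ⟨C, hC, C', hC', fun h => (sidesGraph 𝒟).loopless.irrefl x (hA x hx x (h ▸ hx)),
      hx, hy, fun a ha b hb => ⟨fun hab => ?_, fun hab => ?_⟩, hr, hd⟩
    · exact ⟨C, hC, C', hC', ha, hb, hab, hA, hr, hd⟩
    · obtain ⟨_, _, _, _, _, _, hab, _⟩ := hab
      exact hab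
  · intro x y hxy
    rw [SimpleGraph.Subgraph.deleteEdges_adj]
    exact ⟨(h𝒟.dense D hD).1.2 hxy, fun h => hXadj h (spotGraph_adj.mpr ⟨D, hD, hxy⟩)⟩
  · rintro C hC C' hC' ⟨x, hx, y, hy, C₁, hC₁, C₂, hC₂, hx', hy', -, hA, -⟩
    obtain ⟨D, hD, hxy⟩ := hA x hx' y hy'
    refine ⟨D, hD, hxy.imp (fun h => ⟨fun z hz => ?_, fun z hz => ?_⟩)
      (fun h => ⟨fun z hz => ?_, fun z hz => ?_⟩)⟩
    · exact ((hcolour C hC x hx z hz).1 D hD).1.mp h.1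
    · exact ((hcolour C' hC' y hy z hz).1 D hD).2.mp h.2
    · exact ((hcolour C hC x hx z hz).1 D hD).2.mp h.1
    · exact ((hcolour C' hC' y hy z hz).1 D hD).1.mp h.2
  · intro C hC
    obtain ⟨x, hx⟩ := hne C hC
    refine ⟨j, (em (x ∈ X.verts)).imp (fun h z hz => ?_) (fun h z hz => ?_)⟩
    · exact ⟨hpart (hCB C hC hz), (hcolour C hC x hx z hz).2.mp h⟩
    · exact ⟨hpart (hCB C hC hz), fun hz' => h ((hcolour C hC x hx z hz).2.mpr hz')⟩
  · intro C hC D hD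
    obtain ⟨x, hx⟩ := hne C hC
    constructor
    · by_cases h : x ∈ D.left
      · exact Or.inr fun z hz => ((hcolour C hC x hx z hz).1 D hD).1.mp h
      · exact Or.inl (disjoint_left.mpr fun z hz hz' =>
          h (((hcolour C hC x hx z hz).1 D hD).1.mpr hz'))
    · by_cases h : x ∈ D.right
      · exact Or.inr fun z hz => ((hcolour C hC x hx z hz).1 D hD).2.mp h
      · exact Or.inl (disjoint_left.mpr fun z hz hz' =>
          h (((hcolour C hC x hx z hz).1 D hD).2.mpr hz'))
  · rw [hE]
    rintro x ⟨⟨y, hy⟩, hx⟩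
    exact ⟨hverts x y hy, fun ⟨C, hC, hxC⟩ => hx C hC hxC⟩

/-- A covered edge missing `E` joins two clusters which, by colour, are completely joined in
`sidesGraph`; if uncaptured, it lies in an irregular pair (`I`) or a sparse one (`J`). An uncovered
edge outside `X` was lost in the peeling. -/
lemma IsGoodFamily.ncard_uncaptured_le {τ : ℝ} (hγ : 0 < γ)
    (h𝒟 : IsSpotFamily B (γ * k) γ 𝒟)
    (hXcard : (((B.deleteEdges (spotGraph 𝒟).edgeSet).edgeSet \ X.edgeSet).ncard : ℝ) ≤
      ρ * k * Fintype.card V)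
    (hP : IsGoodFamily (sidesGraph 𝒟) (spotColour 𝒟 X.verts) ν ε δ k c P)
    (hirr : (#(irregularPairs (sidesGraph 𝒟) B.spanningCoe ε P) : ℝ) * (c : ℝ) ^ 2 ≤
      τ * k * Fintype.card V)
    (hB : 2 * (B.edgeSet.ncard : ℝ) ≤ k * Fintype.card V)
    {E : Set V} (hE : E = {x | (∃ y, (sidesGraph 𝒟).Adj x y) ∧ ∀ C ∈ P, x ∉ C}) :
    ((B.edgeSet \ boundedCaptured (P : Set (Finset V)) 𝒟
      (regularGraph B (sidesGraph 𝒟) ε γ P) X E).ncard : ℝ) ≤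
        (τ + γ + ρ) * k * Fintype.card V := by
  set A := sidesGraph 𝒟 with hA
  set I : Finset (V × V) :=
    (irregularPairs A B.spanningCoe ε P).biUnion fun p => p.1 ×ˢ p.2 with hI
  set Q : Finset (Finset V × Finset V) := {p ∈ P ×ˢ P | (∀ x ∈ p.1, ∀ y ∈ p.2, A.Adj x y) ∧
    density B.spanningCoe p.1 p.2 < γ ^ 2} with hQ
  set J : Finset (V × V) := Q.biUnion fun p => B.spanningCoe.interedges p.1 p.2 with hJ
  have hIcard : (#I : ℝ) ≤ τ * k * Fintype.card V := by
    refine le_trans ?_ hirr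
    have : #I ≤ ∑ p ∈ irregularPairs A B.spanningCoe ε P, c ^ 2 := by
      refine card_biUnion_le.trans (sum_le_sum fun p hp => le_of_eq ?_)
      have hp' := mem_irregularPairs.mp hp
      rw [card_product, hP.card_eq _ hp'.1, hP.card_eq _ hp'.2.1, sq]
    rw [sum_const, smul_eq_mul] at this
    exact_mod_cast this
  -- One factor `γ` of the threshold `γ ^ 2` pays for the number of pairs in `A`, which is at most
  -- `k * n / γ`.
  have hJcard : (#J : ℝ) ≤ γ * k * Fintype.card V := by
    have h1 := hP.toIsClusterFamily.card_sparse_le (H := B.spanningCoe) (sq_nonneg γ) (Q := Q)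
      fun p hp => by simpa [hQ, and_assoc] using hp
    have h2 := h𝒟.mul_card_sidesGraph_le hγ
    calc (#J : ℝ) ≤ γ * (γ * #{w : V × V | A.Adj w.1 w.2}) := by
          refine h1.trans (le_of_eq ?_)
          ring
      _ ≤ γ * (k * Fintype.card V) := by
          exact mul_le_mul_of_nonneg_left (h2.trans hB) hγ.le
      _ = _ := by ring
  have hsub : B.edgeSet \ boundedCaptured (P : Set (Finset V)) 𝒟 (regularGraph B A ε γ P) X E ⊆
      ((B.deleteEdges (spotGraph 𝒟).edgeSet).edgeSet \ X.edgeSet) ∪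
        ((I ∪ J).image fun z => s(z.1, z.2) : Finset (Sym2 V)) := by
    rintro e ⟨he, he'⟩
    induction e with
    | _ x y =>
    have hxy : B.Adj x y := he
    simp only [boundedCaptured, Set.mem_union, not_or] at he'
    obtain ⟨⟨h1, h2⟩, h3⟩ := he'
    by_cases hs : (spotGraph 𝒟).Adj x y
    · have hAxy : A.Adj x y := spotGraph_le_sidesGraph hs
      have hcases : ∀ z w, A.Adj z w → z ∈ E ∨ ∃ C ∈ P, z ∈ C := by
        intro z w hzw
        by_cases hz : ∃ C ∈ P, z ∈ C
        · exact Or.inr hz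
        · push Not at hz
          rw [hE]
          exact Or.inl ⟨⟨w, hzw⟩, hz⟩
      have hxE : x ∉ E := fun hx => h3 ⟨x, hx, y, hcases y x hAxy.symm, hs, rfl⟩
      have hyE : y ∉ E := fun hy =>
        h3 ⟨y, hy, x, hcases x y hAxy, hs.symm, Sym2.eq_swap⟩
      obtain ⟨C, hC, hxC⟩ := (hcases x y hAxy).resolve_left hxE
      obtain ⟨C', hC', hyC'⟩ := (hcases y x hAxy.symm).resolve_left hyE
      have hcomplete : ∀ a ∈ C, ∀ b ∈ C', A.Adj a b := fun a ha b hb =>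
        respectsColour_sidesGraph 𝒟 X.verts x a y b (hP.mono C hC x hxC a ha)
          (hP.mono C' hC' y hyC' b hb) hAxy
      refine Or.inr (mem_coe.mpr (mem_image.mpr ⟨(x, y), mem_union.mpr ?_, rfl⟩))
      by_cases hu : B.spanningCoe.IsUniform ε C C'
      · refine Or.inr (mem_biUnion.mpr ⟨(C, C'), ?_, ?_⟩)
        · simp only [hQ, mem_filter, mem_product]
          refine ⟨⟨hC, hC'⟩, hcomplete, ?_⟩
          by_contra! hd
          refine h1 ⟨C, hC, C', hC', hxC, hyC', hxy, hcomplete, ⟨?_, ?_⟩, hd⟩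
          · exact disjoint_left.mpr fun z hz hz' => A.loopless.irrefl z (hcomplete z hz z hz')
          · convert hu
        · rw [SimpleGraph.mem_interedges_iff]
          exact ⟨hxC, hyC', hxy⟩
      · refine Or.inl (mem_biUnion.mpr ⟨(C, C'), ?_, mem_product.mpr ⟨hxC, hyC'⟩⟩)
        exact mem_irregularPairs.mpr ⟨hC, hC', hcomplete, hu⟩
    · refine Or.inl ⟨?_, h2⟩
      rw [SimpleGraph.Subgraph.mem_edgeSet, SimpleGraph.Subgraph.deleteEdges_adj]
      exact ⟨hxy, hs⟩
  have h1 := (Set.ncard_le_ncard hsub (Set.toFinite _)).trans (Set.ncard_union_le _ _)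
  rw [Set.ncard_coe_finset] at h1
  have h2 : #((I ∪ J).image fun z => s(z.1, z.2)) ≤ #I + #J :=
    card_image_le.trans (card_union_le _ _)
  have h3 := (Nat.cast_le (α := ℝ)).mpr (h1.trans (Nat.add_le_add_left h2 _))
  push_cast at h3
  linarith

end Assembly

/-- Graphs of bounded maximum degree have bounded decompositions. -/
theorem exists_boundedDecomposition {Ω Λ γ ε ρ τ : ℝ} (hΩ : 0 < Ω) (hγ : 0 < γ)
    (hε : 0 < ε) (hρ : 0 < ρ) (hτ : 0 < τ) :
    ∃ ν : ℝ, 0 < ν ∧ ∃ k₀ : ℕ, ∀ (V : Type u) [Fintype V] [Nonempty V] (G : SimpleGraph V)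
      (B : G.Subgraph) (k : ℝ), (k₀ : ℝ) < k →
      (∀ v, ((B.neighborSet v).ncard : ℝ) ≤ Ω * k) →
      2 * (B.edgeSet.ncard : ℝ) ≤ k * Fintype.card V →
      ∀ part : Fin 1 → Set V, B.verts ⊆ part 0 →
      ∃ clusters 𝒟 Greg Gexp E,
        IsBoundedDecomposition B part k Λ γ ε ν ρ clusters 𝒟 Greg Gexp E ∧
        ((B.edgeSet \ boundedCaptured clusters 𝒟 Greg Gexp E).ncard : ℝ) ≤
          (τ + γ + ρ) * k * Fintype.card V := by
  -- `q` bounds the number of colours of bad vertices, so a residue of `ε / q * k` per colour totals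
  -- at most `ε * k`. As `q ≥ 1`, the bound `ε / q * k` on cluster sizes also implies `ε * k`.
  set q := 2 * (4 : ℝ) ^ ⌊Λ * Ω / γ ^ 3⌋₊ with hq
  have hq1 : 1 ≤ q := by
    have : (1 : ℝ) ≤ 4 ^ ⌊Λ * Ω / γ ^ 3⌋₊ := one_le_pow₀ (by norm_num)
    linarith
  have hδ : 0 < ε / q := by positivity
  obtain ⟨ν, hν, k₀, h⟩ := exists_regular_family.{u, u} (K := (Ω / γ) ^ 2) (by positivity)
    hδ hε hτ
  refine ⟨ν, hν, k₀, fun V _ _ G B k hk hd hB part hpart => ?_⟩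
  have hk0 : 0 < k := (Nat.cast_nonneg _).trans_lt hk
  obtain ⟨𝒟, h𝒟, hnd⟩ := exists_maximal_spotFamily B (γ * k) γ
  obtain ⟨X, hX, hXnd, hXdeg, hXcard⟩ := exists_nowhereDense_part _ (mul_pos hρ hk0).le hnd
  obtain ⟨c, P, hP, hirr⟩ := h V _ (sidesGraph 𝒟) B.spanningCoe (spotColour 𝒟 X.verts) k hk
    (respectsColour_sidesGraph _ _) fun x => by
      refine (h𝒟.sidesGraph_degree_le (mul_pos hγ hk0) hγ hd x).trans (le_of_eq ?_)
      field_simp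
  have hc : 0 < c := by
    have : (0 : ℝ) < c := (mul_pos hν hk0).trans_le hP.le_card
    exact_mod_cast this
  have hP' : IsGoodFamily (sidesGraph 𝒟) (spotColour 𝒟 X.verts) ν ε (ε / q) k c P :=
    ⟨hP.toIsClusterFamily, hP.le_card,
      hP.card_le.trans (mul_le_mul_of_nonneg_right (div_le_self hε.le hq1) hk0.le), hP.residue_le⟩
  have havoid := h𝒟.isAvoiding (ε := ε) hγ hk0 hΩ hδ hd (by rw [← hq]; field_simp; rfl) B X.verts
    hP.residue_le
  exact ⟨_, _, _, _, _, hP'.isBoundedDecomposition h𝒟 hX hXnd hXdeg hc rfl havoid hpart,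
    hP'.ncard_uncaptured_le hγ h𝒟 hXcard hirr hB rfl⟩

/-- Capturing nothing is enough when the permitted error is at least the number of edges. -/
lemma isSparseDecomposition_empty {V : Type*} [Fintype V] {G : SimpleGraph V}
    {k Ω₂ Ω₁ Λ γ ε ν ρ : ℝ} (hΩ : 0 ≤ Ω₁) (hk : 0 ≤ k) (hε : 0 ≤ ε) :
    IsSparseDecomposition (fun _ : Fin 1 => (Set.univ : Set V)) k Ω₂ Ω₁ Λ γ ε ν ρ
      (⟨∅, ∅, ∅, ⊥, ⊥, ∅⟩ : SparseData G) where
  huge_degree := by simp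
  bounded_degree := fun v _ => by
    have : {w | (spotGraph (∅ : Set (BipSubgraph G))).Adj v w ∨ (⊥ : G.Subgraph).Adj v w ∨
        (G.Adj v w ∧ (v ∈ (∅ : Set V) ∨ w ∈ (∅ : Set V)))} = ∅ := by
      ext w
      simp [spotGraph]
    rw [this]
    simpa using mul_nonneg hΩ hk
  bounded :=
    { exp_le := bot_le
      exp_nowhereDense := fun D hD => by
        obtain ⟨e, he⟩ := hD.2.1
        have := SimpleGraph.Subgraph.edgeSet_mono hD.1 he
        simp at this
      exp_minDegree := by simp
      clusters_subset := by simp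
      clusters_disjoint := by simp
      reg_le := bot_le
      reg_verts := by simp
      reg_pairs := by simp
      cluster_card_eq := by simp
      cluster_card_ge := by simp
      cluster_card_le := by simp
      spots_dense := by simp
      spots_edgeDisjoint := by simp
      spots_cover := by simp
      reg_in_spot := by simp
      cluster_part := by simp
      cluster_spot := by simp
      avoiding_subset := by simp
      avoiding := ⟨by simp, fun _ _ _ => by simpa using mul_nonneg hε hk⟩ }

/-- A sparse decomposition from a bounded decomposition of the graph without its huge vertices. -/
lemma exists_sparseDecomposition_of_degree_gap {Ω Λ γ ε ρ τ : ℝ} (hΩ : 0 < Ω)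
    (hγ : 0 < γ) (hε : 0 < ε) (hρ : 0 < ρ) (hτ : 0 < τ) :
    ∃ ν : ℝ, 0 < ν ∧ ∃ k₀ : ℕ, ∀ (V : Type u) [Fintype V] [Nonempty V] (G : SimpleGraph V)
      (k Ω₂ Ω₁ : ℝ) (H : Set V), (k₀ : ℝ) < k → Ω₁ ≤ Ω →
      (∀ v ∈ H, Ω₂ * k ≤ ((G.neighborSet v).ncard : ℝ)) →
      (∀ v, v ∉ H → ((G.neighborSet v).ncard : ℝ) ≤ Ω₁ * k) →
      2 * (G.edgeSet.ncard : ℝ) ≤ k * Fintype.card V →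
      ∃ D : SparseData G, IsSparseDecomposition (fun _ : Fin 1 => (Set.univ : Set V))
        k Ω₂ Ω₁ Λ γ ε ν ρ D ∧
        ((G.edgeSet \ D.captured).ncard : ℝ) ≤ (τ + γ + ρ) * k * Fintype.card V := by
  obtain ⟨ν, hν, k₀, h⟩ := exists_boundedDecomposition.{u} (Λ := Λ) hΩ hγ hε hρ hτ
  refine ⟨ν, hν, k₀, fun V _ _ G k Ω₂ Ω₁ H hk hΩ₁ hhuge hbdd hG => ?_⟩
  have hk0 : 0 < k := (Nat.cast_nonneg _).trans_lt hk
  set B := (⊤ : G.Subgraph).deleteVerts H with hB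
  have hBadj : ∀ v w, B.Adj v w ↔ v ∉ H ∧ w ∉ H ∧ G.Adj v w := by
    intro v w
    simp [hB]
  have hdeg : ∀ v, ((B.neighborSet v).ncard : ℝ) ≤ Ω * k := by
    intro v
    by_cases hv : v ∈ H
    · have : B.neighborSet v = ∅ := by
        ext w
        simp [hBadj, hv]
      rw [this]
      simpa using (mul_pos hΩ hk0).le
    · calc ((B.neighborSet v).ncard : ℝ) ≤ ((G.neighborSet v).ncard : ℝ) :=
            Nat.cast_le.mpr (Set.ncard_le_ncard (fun w hw => ((hBadj v w).mp hw).2.2)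
              (Set.toFinite _))
        _ ≤ Ω₁ * k := hbdd v hv
        _ ≤ Ω * k := by gcongr
  have hBe : 2 * (B.edgeSet.ncard : ℝ) ≤ k * Fintype.card V := by
    refine le_trans ?_ hG
    gcongr
    · exact Set.toFinite _
    · exact B.edgeSet_subset
  obtain ⟨clusters, 𝒟, Greg, Gexp, E, hdec, hcap⟩ := h V G B k hk hdeg hBe
    (fun j => Set.univ \ H) (by simp [hB])
  refine ⟨⟨H, clusters, 𝒟, Greg, Gexp, E⟩, ⟨hhuge, fun v hv => ?_, hdec⟩, ?_⟩
  · refine le_trans (Nat.cast_le.mpr (Set.ncard_le_ncard ?_ (Set.toFinite _))) (hbdd v hv)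
    rintro w (hw | hw | hw)
    · exact hw.adj_sub
    · exact hw.adj_sub
    · exact hw.1
  · refine le_trans (Nat.cast_le.mpr (Set.ncard_le_ncard ?_ (Set.toFinite _))) hcap
    rintro e ⟨he, he'⟩
    refine ⟨?_, fun hc => he' ?_⟩
    · induction e with
      | _ x y =>
        refine (hBadj x y).mpr ⟨fun hx => ?_, fun hy => ?_, he⟩
        · exact he' (Or.inl (Or.inr ⟨he, x, hx, Sym2.mem_mk_left _ _⟩))
        · exact he' (Or.inl (Or.inr ⟨he, y, hy, Sym2.mem_mk_right _ _⟩))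
    · rcases hc with hc | hc
      · exact Or.inl (Or.inl hc)
      · exact Or.inr hc

end Decomposition
end SparseDecomp

/-! ### Choice of the constants, uniformly in `Ω`. -/

theorem mainTheorem5 (η Λ γ ε ρ : ℝ) (hη : 0 < η) (hη4 : η ≤ 4) (hΛ : 0 < Λ) (hγ : 0 < γ)
    (hε : 0 < ε) (hρ : 0 < ρ) :
    ∃ ν : ℝ, 0 < ν ∧ ∃ k₀ : ℕ,
      ∀ Ω : ℕ → ℝ, (∀ j, 1 ≤ j → 0 < Ω j) → (∀ j, 1 ≤ j → Ω j / Ω (j + 1) ≤ η / 4) →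
      ∀ (V : Type*) [Fintype V] (G : SimpleGraph V) (n : ℕ) (k : ℝ),
        Fintype.card V = n → SparseDecomp.avgDegree G = k → (k₀ : ℝ) < k →
        ∃ i : ℕ, 1 ≤ i ∧ (i : ℝ) ≤ 4 / η ∧
          ∃ G' : SimpleGraph V, G' ≤ G ∧
            ((G.edgeSet \ G'.edgeSet).ncard : ℝ) ≤ η * k * n ∧
            ∃ D : SparseDecomp.SparseData G',
              SparseDecomp.IsSparseDecomposition (fun _ : Fin 1 => (Set.univ : Set V))
                k (Ω (i + 1)) (Ω i) Λ γ ε ν ρ D ∧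
              ((G'.edgeSet \ D.captured).ncard : ℝ) ≤
                (4 * ε / γ + ε * Ω ⌊4 / η⌋₊ + γ + ρ) * k * n ∧
              ((G.edgeSet \ D.captured).ncard : ℝ) ≤
                (η + 4 * ε / γ + ε * Ω ⌊4 / η⌋₊ + γ + ρ) * k * n := by
  -- The degree bound `1 / (2 * ε)` does not involve the sequence `Ω`, so neither do `ν` and `k₀`.
  -- The regularity lemma tolerates any positive `τ`; `4 * ε / γ` is the allowance in the statement.
  obtain ⟨ν, hν, k₀, h⟩ := SparseDecomp.exists_sparseDecomposition_of_degree_gap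
    (Ω := 1 / (2 * ε)) (Λ := Λ) (by positivity) hγ hε hρ (τ := 4 * ε / γ) (by positivity)
  refine ⟨ν, hν, k₀, fun Ω hpos hratio V _ G n k hn hk hk₀ => ?_⟩
  subst hn
  have hk0 : 0 < k := (Nat.cast_nonneg _).trans_lt hk₀
  have hkn := SparseDecomp.mul_card_eq_of_avgDegree hk hk0
  have hkn0 : 0 ≤ k * Fintype.card V := by positivity
  have hfloor : 1 ≤ ⌊4 / η⌋₊ := by
    rw [Nat.one_le_floor_iff, le_div_iff₀ hη]
    linarith
  have hΩpos : 0 < Ω ⌊4 / η⌋₊ := hpos _ hfloor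
  suffices hmain : ∃ i : ℕ, 1 ≤ i ∧ (i : ℝ) ≤ 4 / η ∧
      ∃ G' : SimpleGraph V, G' ≤ G ∧
        ((G.edgeSet \ G'.edgeSet).ncard : ℝ) ≤ η * k * Fintype.card V ∧
        ∃ D : SparseDecomp.SparseData G',
          SparseDecomp.IsSparseDecomposition (fun _ : Fin 1 => (Set.univ : Set V))
            k (Ω (i + 1)) (Ω i) Λ γ ε ν ρ D ∧
          ((G'.edgeSet \ D.captured).ncard : ℝ) ≤
            (4 * ε / γ + ε * Ω ⌊4 / η⌋₊ + γ + ρ) * k * Fintype.card V by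
    obtain ⟨i, hi1, hi2, G', hG', hdiff, D, hD, hcap⟩ := hmain
    refine ⟨i, hi1, hi2, G', hG', hdiff, D, hD, hcap, ?_⟩
    have hsub : G.edgeSet \ D.captured ⊆ G.edgeSet \ G'.edgeSet ∪ G'.edgeSet \ D.captured := by
      rintro e ⟨he, he'⟩
      by_cases hG : e ∈ G'.edgeSet
      · exact Or.inr ⟨hG, he'⟩
      · exact Or.inl ⟨he, hG⟩
    have h1 := (Set.ncard_le_ncard hsub (Set.toFinite _)).trans (Set.ncard_union_le _ _)
    have h2 := (Nat.cast_le (α := ℝ)).mpr h1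
    push_cast at h2
    linarith
  have hγερ : 0 ≤ 4 * ε / γ + γ + ρ := by positivity
  -- In the first case the term `ε * Ω ⌊4 / η⌋₊ * k * n` alone is at least `e(G) = k * n / 2`. In
  -- the second, monotonicity of `Ω` gives `Ω i ≤ 1 / (2 * ε)` for every `i ≤ 4 / η`.
  rcases le_or_gt (1 / 2) (ε * Ω ⌊4 / η⌋₊) with hbig | hsmall
  · refine ⟨1, le_rfl, ?_, G, le_rfl, ?_, ⟨∅, ∅, ∅, ⊥, ⊥, ∅⟩,
      SparseDecomp.isSparseDecomposition_empty (hpos 1 le_rfl).le hk0.le hε.le, ?_⟩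
    · rw [Nat.cast_one, le_div_iff₀ hη]
      linarith
    · rw [Set.sdiff_self, Set.ncard_empty, Nat.cast_zero]
      positivity
    · refine (Nat.cast_le.mpr (Set.ncard_le_ncard Set.sdiff_subset (Set.toFinite _))).trans ?_
      nlinarith
  · obtain ⟨i, hi1, hi2, G', hG', hdiff, H, hhuge, hbdd⟩ :=
      SparseDecomp.exists_degree_gap G hη hη4 hpos hratio hk hk0
    have hV : Nonempty V := by
      by_contra hV
      rw [not_nonempty_iff] at hV
      rw [SparseDecomp.avgDegree, Nat.card_eq_fintype_card, Fintype.card_eq_zero, Nat.cast_zero,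
        div_zero] at hk
      exact hk0.ne hk
    have hΩi : Ω i ≤ 1 / (2 * ε) := by
      rw [le_div_iff₀ (by positivity)]
      have := SparseDecomp.le_of_ratio hη4 hpos hratio hi1 (Nat.le_floor hi2)
      nlinarith
    have hG'e : 2 * (G'.edgeSet.ncard : ℝ) ≤ k * Fintype.card V := by
      rw [hkn]
      gcongr
      exact Set.toFinite _
    obtain ⟨D, hD, hcap⟩ := h V G' k (Ω (i + 1)) (Ω i) H hk₀ hΩi hhuge hbdd hG'e
    refine ⟨i, hi1, hi2, G', hG', hdiff, D, hD, hcap.trans ?_⟩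
    have : 0 ≤ ε * Ω ⌊4 / η⌋₊ * (k * Fintype.card V) := by positivity
    linarith
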